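/- **Model.** A network is a connected $n$-node graph $G$ whose nodes have the identifiers $0,\dots,n-1$; the input of a node consists of its identifier, the identifier of its parent in a spanning tree of $G$ rooted at node $0$, and a label. An $(r,\ell)$ distributed interactive proof has $r=r(n)$ alternating rounds, the last one the prover's: in a prover round an unbounded, randomized prover, who knows the network and all earlier messages of the nodes, sends $\ell(n)$ bits to each node; in a verifier round each node sends the prover $\ell(n)$ bits computed from its input, its private coins and the prover messages that it received before. Afterwards the nodes run a verification algorithm, without the prover, and each of them accepts or rejects. $\mathcal C[c,b]$ denotes the distributed algorithms with $c$ synchronous rounds in which neighbours exchange at most $b(n)$ bits per edge direction and round. The view of a node consists of its coins and of all messages that it receives from the prover and from its neighbours. A set $\mathcal L$ of networks is in $\mathrm{dStatZK}[r,\ell,\mathcal C[c,b]]$ if there are such a proof with verification algorithm in $\mathcal C[c,b]$, an honest prover, and a randomized simulator in $\mathcal C[c,b]$ (which has no prover and starts from the inputs of the nodes only) such that * for every network in $\mathcal L$, the honest prover makes all nodes accept with probability at least $2/3$; * for every network not in $\mathcal L$ and every prover, all nodes accept with probability at most $1/3$; * for every polynomial $p$ and all sufficiently large $n$, for every $n$-node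 network in $\mathcal L$ and every node $v$, the total variation distance between the output of the simulator at $v$ and the view of $v$ in the interaction with the honest prover is at most $1/p(n)$. **Theorem.** Let $k=k(n)$, let $H=H_n$ be a graph on $k$ nodes (known to all nodes), and let $q=q(n)$ be a prime such that either $k\in\mathcal O(1)$ and $q\in n^{\omega(1)}$, or $k\in\omega(1)$ and $q>n^k$ for all large $n$. Let $\textsc{subgraph-counting}(H)$ be the set of networks in which the label of every node is one and the same number $\Delta$ and the number of copies of $H$ in $G$ is exactly $\Delta$. Here the copies are either all subgraphs of $G$ isomorphic to $H$, or only the induced ones, and the theorem holds for both versions. Then $$\textsc{subgraph-counting}(H)\in \mathrm{dStatZK}\bigl[\mathcal O(k\log n),\ \mathcal O(\log q),\ \mathcal C[\mathcal O(1),\mathcal O(\log q)]\bigr],$$ where the constants in the $\mathcal O$'s are absolute (and the bounds that depend on $n$ hold for all sufficiently large $n$). -/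

import Mathlib

noncomputable section

namespace DistZK

/-! ### Networks and distributed languages -/

/-- An `n`-node connected communication graph together with the input of every node. The node with
identifier `i ∈ {0, …, n-1}` is the vertex `i`. Besides its identifier, the input of a node contains
the identifier of its parent in some spanning tree of the graph rooted at node `0` (by convention
the root is its own parent) and a problem-specific label. -/
structure Network (n : ℕ) (Λ : Type) where
  graph : SimpleGraph (Fin n)
  connected : graph.Connected
  parent : Fin n → Fin n
  parent_root : ∀ v, v.val = 0 → parent v = v
  adj_parent : ∀ v, v.val ≠ 0 → graph.Adj v (parent v)
  reaches_root : ∀ v, ∃ m : ℕ, (parent^[m] v).val = 0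
  label : Fin n → Λ

/-- What a node knows before any communication takes place. -/
structure LocalInput (n : ℕ) (Λ : Type) where
  id : Fin n
  parent : Fin n
  label : Λ

/-- The input of node `v`. -/
def Network.input {n : ℕ} {Λ : Type} (N : Network n Λ) (v : Fin n) : LocalInput n Λ :=
  ⟨v, N.parent v, N.label v⟩

/-- A distributed language: a set of networks with inputs (of every size `n`). -/
def DistLanguage (Λ : Type) : Type := (n : ℕ) → Set (Network n Λ)

/-! ### Distributed algorithms -/

/-- Messages of `b` bits. -/
abbrev Msg (b : ℕ) : Type := Fin b → Bool

/-- What a node receives in one communication round: one message from every neighbour (indexed by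
the identifier of the sender), and nothing from the other nodes. -/
abbrev Inbox (n b : ℕ) : Type := Fin n → Option (Msg b)

/-- A synchronous distributed algorithm on `n`-node networks with `b`-bit messages. In each round
every node computes, from its local data and the list of its previous inboxes, one message for each
of its neighbours; when the communication is over it computes its output. -/
structure LocalAlg (n b : ℕ) (In Out : Type) where
  send : In → List (Inbox n b) → Fin n → Msg b
  out : In → List (Inbox n b) → Out

open Classical in
/-- The list of inboxes of node `v` after `t` communication rounds on the graph `G`. -/
def LocalAlg.received {n b : ℕ} {In Out : Type} (A : LocalAlg n b In Out)
    (G : SimpleGraph (Fin n)) (inp : Fin n → In) : ℕ → Fin n → List (Inbox n b)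
  | 0, _ => []
  | t + 1, v => A.received G inp t v ++
      [fun u => if G.Adj u v then some (A.send (inp u) (A.received G inp t u) v) else none]

/-- The output of node `v` when the algorithm is run for `c` communication rounds. -/
def LocalAlg.run {n b : ℕ} {In Out : Type} (A : LocalAlg n b In Out) (c : ℕ)
    (G : SimpleGraph (Fin n)) (inp : Fin n → In) (v : Fin n) : Out :=
  A.out (inp v) (A.received G inp c v)

/-- The parameters of the class `C[c, b]` of distributed algorithms which run for `c` rounds and
send at most `b n` bits over every edge (in each direction) in each round on `n`-node networks. -/
structure AlgClass where
  rounds : ℕ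
  bits : ℕ → ℕ

/-! ### Distributed interactive proofs -/

/-- The verifier of a distributed interactive proof on `n`-node networks, with `ℓ`-bit messages
between nodes and prover and `b`-bit messages between neighbours in the verification phase. Every
node draws its private randomness independently and uniformly from the finite set `Coin`.
`respond` gives the next message of a node to the prover, from the messages that this node has
received so far from the prover; `verify` is the algorithm that is run after the interaction. -/
structure Verifier (n ℓ b : ℕ) (Λ : Type) where
  Coin : Type
  [fintypeCoin : Fintype Coin]
  [nonemptyCoin : Nonempty Coin]
  respond : LocalInput n Λ → Coin → List (Msg ℓ) → Msg ℓ
  verify : LocalAlg n b (LocalInput n Λ × Coin × List (Msg ℓ)) Bool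

attribute [instance] Verifier.fintypeCoin Verifier.nonemptyCoin

/-- A (randomized, computationally unbounded) prover, for a fixed network. The messages that it
sends in its next round depend on its private randomness, uniform on `Seed`, and on all the messages
that it has received from the nodes in the previous rounds. -/
structure Prover (n ℓ : ℕ) where
  Seed : Type
  [fintypeSeed : Fintype Seed]
  [nonemptySeed : Nonempty Seed]
  strategy : Seed → List (Fin n → Msg ℓ) → Fin n → Msg ℓ

attribute [instance] Prover.fintypeSeed Prover.nonemptySeed

/-- The messages exchanged so far: those received by each node from the prover, and those received
by the prover from the nodes. -/
structure Transcript (n ℓ : ℕ) where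
  toNode : Fin n → List (Msg ℓ)
  toProver : List (Fin n → Msg ℓ)

section Execution

variable {n ℓ b : ℕ} {Λ : Type} (V : Verifier n ℓ b Λ) (P : Prover n ℓ) (N : Network n Λ)

/-- The joint randomness of the prover and of all the nodes. -/
abbrev Randomness : Type := P.Seed × (Fin n → V.Coin)

open Classical in
/-- The transcript after the first `i` of `r` rounds of interaction. The rounds alternate between
the prover and the nodes, and the last one (round `r - 1`, counted from `0`) is the prover's. -/
def interact (r : ℕ) (ω : Randomness V P) : ℕ → Transcript n ℓ
  | 0 => ⟨fun _ => [], []⟩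
  | i + 1 =>
    let T := interact r ω i
    if Odd (r - i) then
      ⟨fun v => T.toNode v ++ [P.strategy ω.1 T.toProver v], T.toProver⟩
    else
      ⟨T.toNode, T.toProver ++ [fun v => V.respond (N.input v) (ω.2 v) (T.toNode v)]⟩

/-- The local data with which node `v` starts the verification phase. -/
def verifyInput (r : ℕ) (ω : Randomness V P) (v : Fin n) :
    LocalInput n Λ × V.Coin × List (Msg ℓ) :=
  (N.input v, ω.2 v, (interact V P N r ω r).toNode v)

/-- All nodes accept, after `r` rounds of interaction and `c` rounds of verification. -/
def AllAccept (r c : ℕ) (ω : Randomness V P) : Prop :=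
  ∀ v, V.verify.run c N.graph (verifyInput V P N r ω) v = true

/-- The probability that all nodes accept. -/
def acceptProb (r c : ℕ) : ENNReal :=
  (PMF.uniformOfFintype (Randomness V P)).toOuterMeasure {ω | AllAccept V P N r c ω}

end Execution

/-! ### Zero knowledge -/

/-- The possible views of one node: its private randomness, all the messages it receives from the
prover and all the messages it receives from its neighbours. -/
structure View (n ℓ b : ℕ) (Coin : Type) where
  coin : Coin
  fromProver : List (Msg ℓ)
  fromNeighbors : List (Inbox n b)

/-- The distribution of the view of node `v` in the interactive proof. -/
def viewDist {n ℓ b : ℕ} {Λ : Type} (V : Verifier n ℓ b Λ) (P : Prover n ℓ) (N : Network n Λ)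
    (r c : ℕ) (v : Fin n) : PMF (View n ℓ b V.Coin) :=
  (PMF.uniformOfFintype (Randomness V P)).map fun ω =>
    ⟨ω.2 v, (interact V P N r ω r).toNode v,
      V.verify.received N.graph (verifyInput V P N r ω) c v⟩

/-- A simulator: a randomized distributed algorithm, without prover, in which every node starts
from its own input and private randomness, uniform on `Coin`, and outputs an element of `Out`. -/
structure Simulator (n b : ℕ) (Λ Out : Type) where
  Coin : Type
  [fintypeCoin : Fintype Coin]
  [nonemptyCoin : Nonempty Coin]
  alg : LocalAlg n b (LocalInput n Λ × Coin) Out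

attribute [instance] Simulator.fintypeCoin Simulator.nonemptyCoin

/-- The distribution of the output of the simulator at node `v`. -/
def simDist {n b : ℕ} {Λ Out : Type} (S : Simulator n b Λ Out) (N : Network n Λ) (c : ℕ)
    (v : Fin n) : PMF Out :=
  (PMF.uniformOfFintype (Fin n → S.Coin)).map fun κ =>
    S.alg.run c N.graph (fun u => (N.input u, κ u)) v

/-- Total variation distance of two discrete distributions. -/
def tvDist {α : Type} (μ ν : PMF α) : ℝ := (∑' x, |(μ x).toReal - (ν x).toReal|) / 2

/-- The class `dStatZK[r, ℓ, AV, AS]`. There are a verifier (for each network size `n`) with `r n`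
rounds of interaction, `ℓ n`-bit messages and verification algorithm in `AV`, an honest prover and a
simulator in `AS` such that: the honest prover makes all nodes accept a yes-instance with
probability at least `2/3`; no prover makes all nodes accept a no-instance with probability more
than `1/3`; and on yes-instances with the honest prover, the view of every single node is
statistically indistinguishable from the output of the simulator at this node, i.e. for every
polynomial `p` the distance is at most `1 / p n` for all large `n`. -/
def DStatZK {Λ : Type} (r ℓ : ℕ → ℕ) (AV AS : AlgClass) (L : DistLanguage Λ) : Prop :=
  ∃ (V : (n : ℕ) → Verifier n (ℓ n) (AV.bits n) Λ)
    (honest : (n : ℕ) → Network n Λ → Prover n (ℓ n))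
    (S : (n : ℕ) → Simulator n (AS.bits n) Λ (View n (ℓ n) (AV.bits n) (V n).Coin)),
    (∀ (n : ℕ) (N : Network n Λ), N ∈ L n →
      2 / 3 ≤ acceptProb (V n) (honest n N) N (r n) AV.rounds) ∧
    (∀ (n : ℕ) (N : Network n Λ), N ∉ L n → ∀ P : Prover n (ℓ n),
      acceptProb (V n) P N (r n) AV.rounds ≤ 1 / 3) ∧
    (∀ p : Polynomial ℕ, ∀ᶠ n : ℕ in Filter.atTop, ∀ N : Network n Λ, N ∈ L n → ∀ v : Fin n,
      ((p.eval n : ℕ) : ℝ) * tvDist (simDist (S n) N AS.rounds v)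
        (viewDist (V n) (honest n N) N (r n) AV.rounds v) ≤ 1)

/-! ### Subgraph counting -/

open Classical in
/-- The number of induced copies of `H` in `G`: the number of vertex sets on which `G` induces a
graph isomorphic to `H`. -/
def inducedCopyCount {n k : ℕ} (G : SimpleGraph (Fin n)) (H : SimpleGraph (Fin k)) : ℕ :=
  (Finset.univ.filter fun s : Finset (Fin n) =>
    Nonempty (H ≃g G.induce (s : Set (Fin n)))).card

/-- Non-induced subgraph counting. The pattern for `n`-node networks is `H n`, with `k n` nodes. The
label of each node is the claimed number `Δ` of copies, the same for all nodes. -/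
def subgraphCounting {k : ℕ → ℕ} (H : (n : ℕ) → SimpleGraph (Fin (k n))) : DistLanguage ℕ :=
  fun n => {N | ∃ Δ : ℕ, (∀ v, N.label v = Δ) ∧ N.graph.copyCount (H n) = Δ}

/-- Induced subgraph counting. -/
def inducedSubgraphCounting {k : ℕ → ℕ} (H : (n : ℕ) → SimpleGraph (Fin (k n))) :
    DistLanguage ℕ :=
  fun n => {N | ∃ Δ : ℕ, (∀ v, N.label v = Δ) ∧ inducedCopyCount N.graph (H n) = Δ}

end DistZK

end

/-!
The number of copies of `H`, multiplied by the number of automorphisms of `H`, is the number of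
`k`-tuples of nodes with the right adjacencies. In binary encoding, it is the sum over the Boolean
cube of a product of factors, each of which is a sum over the nodes of terms that a node can compute
from its adjacency row. The sumcheck protocol reduces a claim about this sum to the factors at a
random point.

For zero knowledge, the coefficients of the round polynomials are secret-shared among pairs of nodes
(the coins of the root are public, and round `t` uses coin `t`). The factors `P i` at the random
point are never revealed: the last round polynomial is `∏ i, (P i + z * μ i)` with random masks
`μ i`, and the nodes see only its factors at a random nonzero `z`. Every check is then a linear
equation between sums over the nodes, and the nodes check one combination of all of them, with
powers of the last coin as coefficients: its sum is aggregated along the spanning tree, hidden by a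
mask for each subtree. A fingerprint of all coins, compared between neighbours, forces the prover to
give the same coins to all nodes.

The honest prover is always accepted, and the view of a node is the image of its simulation under a
bijection of the randomness, so the zero knowledge is perfect. A cheating prover passes only if a
nonzero polynomial vanishes at a random coin.
-/

noncomputable section

namespace DistZK

open Finset Function

/-! ### Copies and valid tuples -/

section Copies

variable {ι V W : Type*}

lemma card_iso_self_pos [Finite V] (H : SimpleGraph V) : 0 < Nat.card (H ≃g H) :=
  Nat.card_pos_iff.2 ⟨⟨SimpleGraph.Iso.refl⟩, DFunLike.finite _⟩

lemma card_iso_eq_card_iso_self {G : SimpleGraph V} {H : SimpleGraph W} (h : Nonempty (H ≃g G)) :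
    Nat.card (H ≃g G) = Nat.card (H ≃g H) := by
  obtain ⟨e⟩ := h
  exact Nat.card_congr
    { toFun := fun f => f.trans e.symm
      invFun := fun f => f.trans e
      left_inv := fun f => by ext; simp
      right_inv := fun f => by ext; simp }

open Classical in
lemma card_sigma_iso [Fintype ι] [Finite W] {U : ι → Type*} [∀ i, Finite (U i)]
    (G : ∀ i, SimpleGraph (U i)) (H : SimpleGraph W) :
    Nat.card (Σ i, H ≃g G i) = #{i | Nonempty (H ≃g G i)} * Nat.card (H ≃g H) := by
  have (i : ι) : Finite (H ≃g G i) := DFunLike.finite _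
  rw [Nat.card_sigma, card_filter, sum_mul]
  refine sum_congr rfl fun i _ => ?_
  split_ifs with h
  · rw [card_iso_eq_card_iso_self h, one_mul]
  · rw [zero_mul, Nat.card_eq_zero]
    exact .inl (not_nonempty_iff.1 h)

lemma toSubgraph_coeCopy_comp {G : SimpleGraph V} {H : SimpleGraph W} (G' : G.Subgraph)
    (e : H ≃g G'.coe) : (G'.coeCopy.comp e.toCopy).toSubgraph = G' := by
  change SimpleGraph.Subgraph.map (G'.hom.comp e.toHom) ⊤ = G'
  simp [SimpleGraph.Subgraph.map_comp]

lemma card_copy [Fintype V] [Finite W] (G : SimpleGraph V) (H : SimpleGraph W) :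
    Nat.card (H.Copy G) = G.copyCount H * Nat.card (H ≃g H) := by
  classical
  have count : G.copyCount H = #{G' : G.Subgraph | Nonempty (H ≃g G'.coe)} := by
    rw [SimpleGraph.copyCount]
  rw [count, ← card_sigma_iso]
  refine (Nat.card_congr (Equiv.ofBijective
    (fun p : Σ G' : G.Subgraph, H ≃g G'.coe => p.1.coeCopy.comp p.2.toCopy) ⟨?_, ?_⟩)).symm
  · rintro ⟨G₁, e₁⟩ ⟨G₂, e₂⟩ h
    obtain rfl : G₁ = G₂ := by
      simpa only [toSubgraph_coeCopy_comp] using congrArg SimpleGraph.Copy.toSubgraph h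
    congr 1
    ext w
    exact DFunLike.congr_fun h w
  · exact fun f => ⟨⟨f.toSubgraph, f.isoToSubgraph⟩, SimpleGraph.Copy.ext fun _ => rfl⟩

lemma card_embedding {n k : ℕ} (G : SimpleGraph (Fin n)) (H : SimpleGraph (Fin k)) :
    Nat.card (H ↪g G) = inducedCopyCount G H * Nat.card (H ≃g H) := by
  classical
  rw [inducedCopyCount, ← card_sigma_iso]
  refine (Nat.card_congr (Equiv.ofBijective
    (fun p : Σ s : Finset (Fin n), H ≃g G.induce (s : Set (Fin n)) =>
      (SimpleGraph.Embedding.induce (p.1 : Set (Fin n))).comp p.2.toEmbedding) ⟨?_, ?_⟩)).symm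
  · rintro ⟨s₁, e₁⟩ ⟨s₂, e₂⟩ h
    have range_eq : ∀ (s : Finset (Fin n)) (e : H ≃g G.induce (s : Set (Fin n))),
        Set.range ((SimpleGraph.Embedding.induce (s : Set (Fin n))).comp e.toEmbedding) = s :=
      fun s e => (e.surjective.range_comp Subtype.val).trans Subtype.range_val
    obtain rfl : s₁ = s₂ := by
      rw [← coe_inj, ← range_eq s₁ e₁, ← range_eq s₂ e₂]
      exact congrArg (fun f : H ↪g G => Set.range f) h
    congr 1
    ext w
    exact congrArg Fin.val (DFunLike.congr_fun h w)
  · intro f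
    have range_eq : Set.range f = (univ.image f : Finset (Fin n)) := by simp
    exact ⟨⟨univ.image f, f.isoInduceRange.trans
      { toEquiv := Equiv.setCongr range_eq, map_rel_iff' := Iff.rfl }⟩,
      RelEmbedding.ext fun _ => rfl⟩

end Copies

section Tuples

variable {V : Type*} {k : ℕ}

open Classical in
/-- The tuple `φ` of vertices of `G` is injective, and the adjacency of any two of its entries, with
indices `j < i`, is allowed by the pattern `pat`. Patterns are indexed by natural numbers, of which
only those below `k` matter. -/
def IsValidTuple (pat : ℕ → ℕ → Bool → Bool) (G : SimpleGraph V) (φ : Fin k → V) : Prop :=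
  ∀ i j : Fin k, j < i → φ i ≠ φ j ∧ pat i j (decide (G.Adj (φ i) (φ j))) = true

lemma IsValidTuple.injective {pat : ℕ → ℕ → Bool → Bool} {G : SimpleGraph V} {φ : Fin k → V}
    (h : IsValidTuple pat G φ) : Injective φ := by
  intro a b hab
  by_contra hne
  rcases lt_or_gt_of_ne hne with hlt | hlt
  · exact (h b a hlt).1 hab.symm
  · exact (h a b hlt).1 hab

/-- The number of tuples of `k` vertices of `G` which are valid for the pattern `pat`. -/
def tupleCount (pat : ℕ → ℕ → Bool → Bool) (k : ℕ) (G : SimpleGraph V) : ℕ :=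
  Nat.card {φ : Fin k → V // IsValidTuple pat G φ}

lemma tupleCount_le [Finite V] (pat : ℕ → ℕ → Bool → Bool) (k : ℕ) (G : SimpleGraph V) :
    tupleCount pat k G ≤ Nat.card V ^ k :=
  (Finite.card_subtype_le _).trans_eq (by simp [Nat.card_fun])

lemma tupleCount_eq_of_le_one (hk : k ≤ 1) (pat : ℕ → ℕ → Bool → Bool) (G G' : SimpleGraph V) :
    tupleCount pat k G = tupleCount pat k G' := by
  have no_pair : ∀ i j : Fin k, ¬ j < i := fun i j => by omega
  simp [tupleCount, IsValidTuple, no_pair]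

lemma tupleCount_eq_zero [Finite V] (hk : Nat.card V < k) (pat : ℕ → ℕ → Bool → Bool)
    (G : SimpleGraph V) : tupleCount pat k G = 0 := by
  refine Nat.card_eq_zero.2 (.inl ⟨fun φ => ?_⟩)
  have := Nat.card_le_card_of_injective φ.1 φ.2.injective
  rw [Nat.card_fin] at this
  omega

open Classical in
/-- The pattern whose valid tuples are the copies of `H`. -/
def copyPattern (H : SimpleGraph (Fin k)) (i j : ℕ) (adj : Bool) : Bool :=
  decide (∀ (hi : i < k) (hj : j < k), H.Adj ⟨i, hi⟩ ⟨j, hj⟩ → adj = true)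

open Classical in
/-- The pattern whose valid tuples are the induced copies of `H`. -/
def inducedPattern (H : SimpleGraph (Fin k)) (i j : ℕ) (adj : Bool) : Bool :=
  decide (∀ (hi : i < k) (hj : j < k), H.Adj ⟨i, hi⟩ ⟨j, hj⟩ ↔ adj = true)

variable (G : SimpleGraph V) (H : SimpleGraph (Fin k))

lemma isValidTuple_copyPattern_iff {φ : Fin k → V} :
    IsValidTuple (copyPattern H) G φ ↔
      Injective φ ∧ ∀ i j, H.Adj i j → G.Adj (φ i) (φ j) := by
  refine ⟨fun h => ⟨h.injective, fun i j hij => ?_⟩, fun h i j hij =>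
    ⟨h.1.ne hij.ne', by simpa [copyPattern] using h.2 i j⟩⟩
  have of_lt : ∀ i j, j < i → H.Adj i j → G.Adj (φ i) (φ j) := fun i j hij => by
    simpa [copyPattern] using (h i j hij).2
  rcases lt_or_gt_of_ne hij.ne with hlt | hlt
  · exact (of_lt j i hlt hij.symm).symm
  · exact of_lt i j hlt hij

lemma isValidTuple_inducedPattern_iff {φ : Fin k → V} :
    IsValidTuple (inducedPattern H) G φ ↔
      Injective φ ∧ ∀ i j, H.Adj i j ↔ G.Adj (φ i) (φ j) := by
  refine ⟨fun h => ⟨h.injective, fun i j => ?_⟩, fun h i j hij =>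
    ⟨h.1.ne hij.ne', by simpa [inducedPattern] using h.2 i j⟩⟩
  have of_lt : ∀ i j, j < i → (H.Adj i j ↔ G.Adj (φ i) (φ j)) := fun i j hij => by
    simpa [inducedPattern] using (h i j hij).2
  rcases lt_trichotomy i j with hlt | rfl | hlt
  · rw [G.adj_comm, H.adj_comm, of_lt j i hlt]
  · simp
  · exact of_lt i j hlt

lemma tupleCount_copyPattern [Fintype V] :
    tupleCount (copyPattern H) k G = G.copyCount H * Nat.card (H ≃g H) := by
  rw [← card_copy, tupleCount]
  simp only [isValidTuple_copyPattern_iff]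
  exact Nat.card_congr
    { toFun := fun φ => ⟨⟨φ.1, fun {i j} => φ.2.2 i j⟩, φ.2.1⟩
      invFun := fun f => ⟨f, f.injective, fun _ _ => f.toHom.map_adj⟩
      left_inv := fun _ => rfl
      right_inv := fun _ => rfl }

lemma tupleCount_inducedPattern {n : ℕ} (G : SimpleGraph (Fin n)) (H : SimpleGraph (Fin k)) :
    tupleCount (inducedPattern H) k G = inducedCopyCount G H * Nat.card (H ≃g H) := by
  rw [← card_embedding, tupleCount]
  simp only [isValidTuple_inducedPattern_iff]
  exact Nat.card_congr
    { toFun := fun φ => ⟨⟨φ.1, φ.2.1⟩, fun {i j} => (φ.2.2 i j).symm⟩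
      invFun := fun f => ⟨f, f.injective, fun _ _ => f.map_adj_iff.symm⟩
      left_inv := fun _ => rfl
      right_inv := fun _ => rfl }

end Tuples

/-! ### Polynomial functions and sums over Boolean cubes -/

section PolynomialFunctions

variable {R ι α : Type*} [CommRing R]

open Polynomial

/-- The univariate function `g` is given by a polynomial of degree at most `d`. -/
def HasDegreeLE (d : ℕ) (g : R → R) : Prop :=
  ∃ p : R[X], p.natDegree ≤ d ∧ ∀ z, p.eval z = g z

namespace HasDegreeLE

variable {d e : ℕ} {f g : R → R}

lemma mono (h : HasDegreeLE d g) (hde : d ≤ e) : HasDegreeLE e g :=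
  h.imp fun _ hp => ⟨hp.1.trans hde, hp.2⟩

lemma const (c : R) : HasDegreeLE d fun _ => c :=
  ⟨C c, by simp, by simp⟩

lemma id : HasDegreeLE 1 fun z : R => z :=
  ⟨X, natDegree_X_le, by simp⟩

lemma add (hf : HasDegreeLE d f) (hg : HasDegreeLE d g) : HasDegreeLE d fun z => f z + g z := by
  obtain ⟨p, hp, hpf⟩ := hf
  obtain ⟨r, hr, hrg⟩ := hg
  exact ⟨p + r, natDegree_add_le_of_degree_le hp hr, by simp [hpf, hrg]⟩

lemma sub (hf : HasDegreeLE d f) (hg : HasDegreeLE d g) : HasDegreeLE d fun z => f z - g z := by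
  obtain ⟨p, hp, hpf⟩ := hf
  obtain ⟨r, hr, hrg⟩ := hg
  exact ⟨p - r, (natDegree_sub_le _ _).trans (max_le hp hr), by simp [hpf, hrg]⟩

lemma mul (hf : HasDegreeLE d f) (hg : HasDegreeLE e g) :
    HasDegreeLE (d + e) fun z => f z * g z := by
  obtain ⟨p, hp, hpf⟩ := hf
  obtain ⟨r, hr, hrg⟩ := hg
  exact ⟨p * r, natDegree_mul_le_of_le hp hr, by simp [hpf, hrg]⟩

lemma sum (s : Finset α) {f : α → R → R} (h : ∀ i ∈ s, HasDegreeLE d (f i)) :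
    HasDegreeLE d fun z => ∑ i ∈ s, f i z := by
  classical
  induction s using Finset.induction_on with
  | empty => simpa only [sum_empty] using const 0
  | insert a s ha ih =>
    simp only [sum_insert ha]
    exact (h a (by simp)).add (ih fun i hi => h i (by simp [hi]))

lemma prod (s : Finset α) {d : α → ℕ} {f : α → R → R} (h : ∀ i ∈ s, HasDegreeLE (d i) (f i)) :
    HasDegreeLE (∑ i ∈ s, d i) fun z => ∏ i ∈ s, f i z := by
  classical
  induction s using Finset.induction_on with
  | empty => simpa only [prod_empty] using const 1
  | insert a s ha ih =>
    simp only [prod_insert ha, sum_insert ha]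
    exact (h a (by simp)).mul (ih fun i hi => h i (by simp [hi]))

lemma exists_coeff (hg : HasDegreeLE d g) {n : ℕ} (hdn : d < n) :
    ∃ c : Fin n → R, ∀ z, g z = ∑ j, c j * z ^ (j : ℕ) := by
  obtain ⟨p, hp, hpg⟩ := hg
  refine ⟨fun j => p.coeff j, fun z => ?_⟩
  rw [← hpg, eval_eq_sum_range' (hp.trans_lt hdn),
    Fin.sum_univ_eq_sum_range (fun j => p.coeff j * z ^ j)]

lemma sum_mul_pow {n : ℕ} (c : Fin n → R) :
    HasDegreeLE (n - 1) fun z => ∑ j, c j * z ^ (j : ℕ) :=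
  sum univ fun j _ => ⟨C (c j) * X ^ (j : ℕ),
    (natDegree_C_mul_X_pow_le _ _).trans (by omega), by simp⟩

lemma card_eq_le [IsDomain R] [Fintype R] [DecidableEq R] (hf : HasDegreeLE d f)
    (hg : HasDegreeLE d g) (hfg : f ≠ g) : #{z | f z = g z} ≤ d := by
  obtain ⟨p, hp, hpf⟩ := hf
  obtain ⟨r, hr, hrg⟩ := hg
  obtain rfl : (p.eval ·) = f := funext hpf
  obtain rfl : (r.eval ·) = g := funext hrg
  by_contra! hcard
  have deg_lt : ∀ {s : R[X]}, s.natDegree ≤ d → s.degree < #{z | p.eval z = r.eval z} :=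
    fun hs => (natDegree_le_iff_degree_le.1 hs).trans_lt (by exact_mod_cast hcard)
  refine hfg (congrArg (fun s : R[X] => (s.eval ·)) ?_)
  exact eq_of_degrees_lt_of_eval_finset_eq _ (deg_lt hp) (deg_lt hr) fun z hz => by simpa using hz

end HasDegreeLE

lemma card_sum_mul_pow_eq_zero_le [IsDomain R] [Fintype R] [DecidableEq R] {a : ℕ → R} {n j : ℕ}
    (hj : j < n) (ha : a j ≠ 0) : #{z | ∑ i ∈ range n, a i * z ^ i = 0} ≤ n - 1 := by
  set p : R[X] := ∑ i ∈ range n, C (a i) * X ^ i with hp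
  have p_ne_zero : p ≠ 0 := fun h => ha <| by
    simpa [hp, finsetSum_coeff, coeff_C_mul, coeff_X_pow, hj] using congrArg (coeff · j) h
  have natDegree_le : p.natDegree ≤ n - 1 :=
    natDegree_sum_le_of_forall_le _ _ fun i hi =>
      (natDegree_C_mul_X_pow_le _ _).trans (Nat.le_pred_of_lt (mem_range.1 hi))
  refine (card_le_degree_of_subset_roots fun z hz => ?_).trans natDegree_le
  rw [mem_roots p_ne_zero, IsRoot, hp, eval_finsetSum]
  simpa using hz

variable [DecidableEq ι]

/-- As a function of the coordinate `t` alone, `f` is given by polynomials of degree at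
most `d`. -/
def CoordDegreeLE (d : ℕ) (t : ι) (f : (ι → R) → R) : Prop :=
  ∀ x, HasDegreeLE d fun z => f (update x t z)

lemma coordDegreeLE_eval (t s : ι) :
    CoordDegreeLE (if s = t then 1 else 0) t fun x : ι → R => x s := by
  intro x
  split_ifs with hst
  · simpa [hst] using HasDegreeLE.id
  · simpa [update_of_ne hst] using HasDegreeLE.const (x s)

/-- The point which agrees with `x` outside `s` and whose coordinates in `s` are the values of the
indicator function of `S`. -/
def cubePoint (s S : Finset ι) (x : ι → R) : ι → R :=
  fun i => if i ∈ s then (if i ∈ S then 1 else 0) else x i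

/-- The sum of `f` over all Boolean values of the coordinates in `s`, which are represented by the
subsets of `s`. -/
def cubeSum (s : Finset ι) (f : (ι → R) → R) (x : ι → R) : R :=
  ∑ S ∈ s.powerset, f (cubePoint s S x)

lemma cubeSum_empty (f : (ι → R) → R) (x : ι → R) : cubeSum ∅ f x = f x := by
  unfold cubeSum cubePoint
  simp

lemma cubeSum_insert {s : Finset ι} {a : ι} (ha : a ∉ s) (f : (ι → R) → R) (x : ι → R) :
    cubeSum (insert a s) f x = cubeSum s f (update x a 0) + cubeSum s f (update x a 1) := by
  rw [cubeSum, sum_powerset_insert ha]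
  congr 1 <;> refine sum_congr rfl fun S hS => congrArg f (funext fun i => ?_)
  all_goals
    rcases eq_or_ne i a with rfl | hia
    · simp [cubePoint, ha, notMem_of_mem_powerset_of_notMem hS ha]
    · simp [cubePoint, hia]

lemma cubeSum_congr {s M : Finset ι} {f : (ι → R) → R}
    (hf : ∀ x y : ι → R, (∀ i ∈ M, x i = y i) → f x = f y) {x y : ι → R}
    (hxy : ∀ i ∈ M, i ∉ s → x i = y i) : cubeSum s f x = cubeSum s f y :=
  sum_congr rfl fun S _ => hf _ _ fun i hi => by
    by_cases his : i ∈ s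
    · simp [cubePoint, his]
    · simp [cubePoint, his, hxy i hi his]

lemma CoordDegreeLE.cubeSum {d : ℕ} {t : ι} {f : (ι → R) → R} (hf : CoordDegreeLE d t f)
    {s : Finset ι} (ht : t ∉ s) : CoordDegreeLE d t (cubeSum s f) := by
  refine fun x => HasDegreeLE.sum _ fun S _ => ?_
  convert hf (cubePoint s S x) using 4 with z
  funext i
  rcases eq_or_ne i t with rfl | hit
  · simp [cubePoint, ht]
  · simp [cubePoint, hit]

end PolynomialFunctions

/-! ### Arithmetization -/

/-- A counting problem for tuples of `κ + 1` nodes of an `n`-node network, each of which is encoded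
by `m` bits. The tuples that are counted are those valid for the pattern `pat`, and a label `Δ`
stands for the claim that their number is `Δ * aut`. -/
structure CountingScheme (n : ℕ) where
  κ : ℕ
  m : ℕ
  pat : ℕ → ℕ → Bool → Bool
  aut : ℕ
  κ_pos : 0 < κ
  κ_lt : κ < n
  n_le : n ≤ 2 ^ m
  aut_pos : 0 < aut

namespace CountingScheme

variable {n : ℕ} (A : CountingScheme n)

/-- The networks with a correct label. -/
def language : Set (Network n ℕ) :=
  {N | ∃ Δ : ℕ, (∀ v, N.label v = Δ) ∧ Δ * A.aut = tupleCount A.pat (A.κ + 1) N.graph}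

/-- An upper bound for the number of valid tuples: larger claims are rejected, so that a claim can
be read off its residue modulo a larger prime. -/
def bound : ℕ := n ^ (A.κ + 1)

lemma tupleCount_le_bound (G : SimpleGraph (Fin n)) :
    tupleCount A.pat (A.κ + 1) G ≤ A.bound :=
  (tupleCount_le _ _ G).trans_eq (by rw [Nat.card_fin, bound])

/-- The number of Boolean variables. -/
def numVars : ℕ := (A.κ + 1) * A.m

/-- The index of the last message of the prover. There is one message for each Boolean variable, one
for the randomized product of the factors, one for each factor, and a last one for the aggregation
of the equations. -/
def lastMsg : ℕ := A.numVars + A.κ + 1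

/-- The number of messages of the prover. -/
def numMsgs : ℕ := A.lastMsg + 1

lemma lastMsg_lt : A.lastMsg < A.numMsgs :=
  Nat.lt_succ_self _

lemma m_pos : 0 < A.m :=
  Nat.pos_of_ne_zero fun hm => by have := A.κ_pos; have := A.κ_lt; have := hm ▸ A.n_le; omega

lemma lt_numVars {i b : ℕ} (hi : i ≤ A.κ) (hb : b < A.m) : i * A.m + b < A.numVars :=
  calc i * A.m + b < (i + 1) * A.m := by rw [Nat.succ_mul]; omega
    _ ≤ A.numVars := Nat.mul_le_mul_right _ (by omega)

end CountingScheme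

section Arithmetization

variable {R : Type*} [CommRing R] {n : ℕ}

/-- The multilinear extension of the indicator function of the first `m` binary digits of `u`. -/
def bitsIndicator (m u : ℕ) (x : ℕ → R) : R :=
  ∏ b ∈ range m, if u.testBit b then x b else 1 - x b

/-- The `i`-th block of `m` variables. -/
def varBlock (m i : ℕ) (x : ℕ → R) : ℕ → R := fun b => x (i * m + b)

lemma coordDegreeLE_bitsIndicator (m u i t : ℕ) :
    CoordDegreeLE (if t / m = i then 1 else 0) t
      fun x : ℕ → R => bitsIndicator m u (varBlock m i x) := by
  let degree : ℕ → ℕ := fun b => if i * m + b = t then 1 else 0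
  have degree_eq : ∀ b ∈ range m, degree b =
      if b = t % m then if t / m = i then 1 else 0 else 0 := by
    intro b hb
    have hbm := mem_range.1 hb
    rw [← ite_and]
    refine if_congr ⟨?_, ?_⟩ rfl rfl
    · rintro rfl
      rw [mul_comm, Nat.mul_add_mod, Nat.mod_eq_of_lt hbm, Nat.mul_add_div (by omega),
        Nat.div_eq_of_lt hbm]
      simp
    · rintro ⟨rfl, rfl⟩
      exact Nat.div_add_mod' t m
  refine fun x => (HasDegreeLE.prod (d := degree) (range m)
    fun b _ => ?_).mono ?_
  · split_ifs with hbit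
    · exact coordDegreeLE_eval t (i * m + b) x
    · exact (HasDegreeLE.const 1).sub (coordDegreeLE_eval t (i * m + b) x)
  · rw [sum_congr rfl degree_eq, sum_ite_eq']
    split_ifs <;> simp

lemma bitsIndicator_cubePoint {m i : ℕ} {s : Finset ℕ} (hs : ∀ b < m, i * m + b ∈ s) (u : ℕ)
    (S : Finset ℕ) (x : ℕ → R) [Decidable (∀ b < m, u.testBit b ↔ i * m + b ∈ S)] :
    bitsIndicator m u (varBlock m i (cubePoint s S x)) =
      if ∀ b < m, u.testBit b ↔ i * m + b ∈ S then 1 else 0 := by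
  split_ifs with h
  · refine prod_eq_one fun b hb => ?_
    have hbm := mem_range.1 hb
    by_cases hbit : u.testBit b
    · simp [hbit, varBlock, cubePoint, hs b hbm, (h b hbm).1 hbit]
    · simp [hbit, varBlock, cubePoint, hs b hbm, mt (h b hbm).2 hbit]
  · push Not at h
    obtain ⟨b, hbm, hne⟩ := h
    refine prod_eq_zero (mem_range.2 hbm) ?_
    rcases hne with ⟨hbit, hmem⟩ | ⟨hbit, hmem⟩ <;>
      simp [hbit, hmem, varBlock, cubePoint, hs b hbm]

open Classical in
/-- The adjacency row of a node. -/
def adjRow (G : SimpleGraph (Fin n)) (u v : Fin n) : Bool := decide (G.Adj u v)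

namespace CountingScheme

variable (A : CountingScheme n) (G : SimpleGraph (Fin n))

/-- The multilinear extension, in the `j`-th block of variables, of the indicator function of the
nodes which may stand at position `j` when `u`, with adjacency row `row`, stands at position `i`. -/
def compatible (i j : ℕ) (u : Fin n) (row : Fin n → Bool) (x : ℕ → R) : R :=
  ∑ v : Fin n, if u ≠ v ∧ A.pat i j (row v) = true then
    bitsIndicator A.m v (varBlock A.m j x) else 0

/-- The summand of the `i`-th factor that the node `u`, with adjacency row `row`, can compute. -/
def nodeTerm (i : ℕ) (u : Fin n) (row : Fin n → Bool) (x : ℕ → R) : R :=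
  bitsIndicator A.m u (varBlock A.m i x) * ∏ j ∈ range i, A.compatible i j u row x

/-- The polynomial that expresses the constraints between the `i`-th entry of a tuple and the
entries before it. -/
def factor (i : ℕ) (x : ℕ → R) : R :=
  ∑ u, A.nodeTerm i u (adjRow G u) x

/-- The polynomial whose sum over the Boolean cube is the number of valid tuples. -/
def countPoly (x : ℕ → R) : R :=
  ∏ i ∈ range A.κ, A.factor G (i + 1) x

variable {A}

lemma bitsIndicator_congr {i : ℕ} (hi : i ≤ A.κ) (u : ℕ) {x y : ℕ → R}
    (h : ∀ t ∈ range A.numVars, x t = y t) :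
    bitsIndicator A.m u (varBlock A.m i x) = bitsIndicator A.m u (varBlock A.m i y) :=
  prod_congr rfl fun b hb => by
    simp only [varBlock, h _ (mem_range.2 (A.lt_numVars hi (mem_range.1 hb)))]

lemma nodeTerm_congr {i : ℕ} (hi : i ≤ A.κ) (u : Fin n) (row : Fin n → Bool) {x y : ℕ → R}
    (h : ∀ t ∈ range A.numVars, x t = y t) : A.nodeTerm i u row x = A.nodeTerm i u row y := by
  unfold nodeTerm compatible
  congr 1
  · exact bitsIndicator_congr hi u h
  · refine prod_congr rfl fun j hj => sum_congr rfl fun v _ => ?_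
    rw [bitsIndicator_congr ((mem_range.1 hj).le.trans hi) v h]

lemma factor_congr {i : ℕ} (hi : i ≤ A.κ) {x y : ℕ → R}
    (h : ∀ t ∈ range A.numVars, x t = y t) : A.factor G i x = A.factor G i y :=
  sum_congr rfl fun u _ => nodeTerm_congr hi u _ h

lemma countPoly_congr {x y : ℕ → R} (h : ∀ t ∈ range A.numVars, x t = y t) :
    A.countPoly G x = A.countPoly G y :=
  prod_congr rfl fun _ hi => factor_congr G (mem_range.1 hi) h

variable (A)

/-- The blocks `0, …, i` are disjoint, so that a variable occurs in at most one of the factors of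
`nodeTerm`. -/
lemma coordDegreeLE_nodeTerm (i t : ℕ) (u : Fin n) (row : Fin n → Bool) :
    CoordDegreeLE 1 t fun x : ℕ → R => A.nodeTerm i u row x := by
  refine fun x => ((coordDegreeLE_bitsIndicator A.m u i t x).mul
    (HasDegreeLE.prod (d := fun j => if t / A.m = j then 1 else 0) (range i) fun j _ =>
      HasDegreeLE.sum _ fun v _ => ?_)).mono ?_
  · by_cases hv : u ≠ v ∧ A.pat i j (row v) = true
    · simpa only [if_pos hv] using coordDegreeLE_bitsIndicator A.m v j t x
    · simpa only [if_neg hv] using HasDegreeLE.const 0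
  · rw [add_comm, ← sum_range_succ (fun j => if t / A.m = j then 1 else 0), sum_ite_eq]
    split_ifs <;> simp

lemma coordDegreeLE_countPoly (t : ℕ) :
    CoordDegreeLE A.κ t fun x : ℕ → R => A.countPoly G x := by
  refine fun x => (HasDegreeLE.prod (d := fun _ => 1) (range A.κ) fun i _ =>
    HasDegreeLE.sum _ fun u _ => A.coordDegreeLE_nodeTerm (i + 1) t u (adjRow G u) x).mono ?_
  simp

/-- The bits of the entries of a tuple, as a point of the Boolean cube. -/
def tupleCode (φ : Fin (A.κ + 1) → Fin n) : Finset ℕ :=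
  {t ∈ range A.numVars | (φ (Fin.ofNat _ (t / A.m)) : ℕ).testBit (t % A.m)}

variable {A} in
lemma mem_tupleCode {φ : Fin (A.κ + 1) → Fin n} {b : ℕ} (i : Fin (A.κ + 1)) (hb : b < A.m) :
    i * A.m + b ∈ A.tupleCode φ ↔ (φ i : ℕ).testBit b := by
  have div_eq : (i * A.m + b) / A.m = i := by
    rw [mul_comm, Nat.mul_add_div (by omega), Nat.div_eq_of_lt hb, add_zero]
  have mod_eq : (i * A.m + b) % A.m = b := by
    rw [mul_comm, Nat.mul_add_mod, Nat.mod_eq_of_lt hb]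
  simp [tupleCode, A.lt_numVars (Nat.lt_succ_iff.1 i.2) hb, div_eq, mod_eq]

variable {A} in
lemma eq_of_testBit_eq {u v : Fin n} (h : ∀ b < A.m, (u : ℕ).testBit b ↔ (v : ℕ).testBit b) :
    u = v := by
  refine Fin.ext (Nat.eq_of_testBit_eq fun b => ?_)
  by_cases hb : b < A.m
  · exact Bool.eq_iff_iff.2 (h b hb)
  · have lt_pow : ∀ w : Fin n, (w : ℕ) < 2 ^ b := fun w =>
      (w.2.trans_le A.n_le).trans_le (Nat.pow_le_pow_right two_pos (not_lt.1 hb))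
    rw [Nat.testBit_lt_two_pow (lt_pow u), Nat.testBit_lt_two_pow (lt_pow v)]

lemma tupleCode_injective : Injective A.tupleCode := by
  intro φ ψ h
  funext i
  refine eq_of_testBit_eq (A := A) fun b hb => ?_
  rw [← mem_tupleCode i hb, h, mem_tupleCode i hb]

lemma exists_tupleCode_eq {S : Finset ℕ} (hS : S ⊆ range A.numVars)
    (h : ∀ i : Fin (A.κ + 1), ∃ u : Fin n, ∀ b < A.m, (u : ℕ).testBit b ↔ i * A.m + b ∈ S) :
    ∃ φ, A.tupleCode φ = S := by
  choose φ hφ using h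
  refine ⟨φ, Finset.ext fun t => ?_⟩
  by_cases ht : t ∈ range A.numVars
  · have hdiv : t / A.m < A.κ + 1 :=
      Nat.div_lt_of_lt_mul (by rw [mul_comm]; exact mem_range.1 ht)
    have hmod := Nat.mod_lt t A.m_pos
    have := (mem_tupleCode ⟨t / A.m, hdiv⟩ hmod).trans (hφ ⟨t / A.m, hdiv⟩ _ hmod)
    rwa [Nat.div_add_mod'] at this
  · exact iff_of_false (fun h => ht (mem_filter.1 h).1) fun h => ht (hS h)

/-- The point of the Boolean cube that encodes a tuple. -/
def tuplePoint (φ : Fin (A.κ + 1) → Fin n) (x : ℕ → R) : ℕ → R :=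
  cubePoint (range A.numVars) (A.tupleCode φ) x

variable (φ : Fin (A.κ + 1) → Fin n) (x : ℕ → R)

lemma bitsIndicator_tuplePoint (i : Fin (A.κ + 1)) (u : Fin n) :
    bitsIndicator A.m u (varBlock A.m i (A.tuplePoint φ x)) = if u = φ i then 1 else 0 := by
  classical
  rw [tuplePoint, bitsIndicator_cubePoint fun b hb =>
    mem_range.2 (A.lt_numVars (Nat.lt_succ_iff.1 i.2) hb)]
  refine if_congr ⟨fun h => eq_of_testBit_eq (A := A) fun b hb => ?_, ?_⟩ rfl rfl
  · rw [h b hb, mem_tupleCode i hb]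
  · rintro rfl b hb
    rw [mem_tupleCode i hb]

lemma compatible_tuplePoint (i : ℕ) (j : Fin (A.κ + 1)) (u : Fin n) (row : Fin n → Bool) :
    A.compatible i j u row (A.tuplePoint φ x) =
      if u ≠ φ j ∧ A.pat i j (row (φ j)) = true then 1 else 0 := by
  rw [compatible, sum_eq_single_of_mem (φ j) (mem_univ _)]
  · rw [bitsIndicator_tuplePoint, if_pos rfl]
  · intro v _ hv
    rw [bitsIndicator_tuplePoint, if_neg hv, ite_self]

lemma factor_tuplePoint (i : Fin (A.κ + 1)) :
    A.factor G i (A.tuplePoint φ x) =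
      ∏ j ∈ range i, A.compatible i j (φ i) (adjRow G (φ i)) (A.tuplePoint φ x) := by
  rw [factor, sum_eq_single_of_mem (φ i) (mem_univ _)]
  · rw [nodeTerm, bitsIndicator_tuplePoint, if_pos rfl, one_mul]
  · intro v _ hv
    rw [nodeTerm, bitsIndicator_tuplePoint, if_neg hv, zero_mul]

open Classical in
lemma countPoly_tuplePoint :
    A.countPoly G (A.tuplePoint φ x) = if IsValidTuple A.pat G φ then 1 else 0 := by
  split_ifs with h
  · refine prod_eq_one fun i hi => ?_
    have hi' : i + 1 < A.κ + 1 := Nat.succ_lt_succ (mem_range.1 hi)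
    rw [A.factor_tuplePoint G φ x ⟨i + 1, hi'⟩]
    refine prod_eq_one fun j hj => ?_
    have hj' : j < i + 1 := mem_range.1 hj
    rw [A.compatible_tuplePoint φ x _ ⟨j, hj'.trans hi'⟩]
    exact if_pos (h ⟨i + 1, hi'⟩ ⟨j, _⟩ hj')
  · unfold IsValidTuple at h
    push Not at h
    obtain ⟨i, j, hji, hne⟩ := h
    have hji' : (j : ℕ) < i := hji
    refine prod_eq_zero (i := (i : ℕ) - 1) (mem_range.2 (by omega)) ?_
    rw [Nat.sub_add_cancel (by omega), A.factor_tuplePoint G φ x i]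
    refine prod_eq_zero (mem_range.2 hji') ?_
    rw [A.compatible_tuplePoint φ x i j, if_neg fun hc => hne hc.1 hc.2]

lemma countPoly_eq_zero {i : Fin (A.κ + 1)} {x : ℕ → R}
    (h : ∀ u : Fin n, bitsIndicator A.m u (varBlock A.m i x) = 0) : A.countPoly G x = 0 := by
  obtain ⟨i, hi⟩ := i
  rcases i with _ | i
  · refine prod_eq_zero (mem_range.2 A.κ_pos) (sum_eq_zero fun u _ => ?_)
    rw [nodeTerm, prod_eq_zero (i := 0) (by simp), mul_zero]
    exact sum_eq_zero fun v _ => by rw [h v, ite_self]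
  · refine prod_eq_zero (mem_range.2 (Nat.lt_of_succ_lt_succ hi)) (sum_eq_zero fun u _ => ?_)
    rw [nodeTerm, h u, zero_mul]

theorem cubeSum_countPoly :
    cubeSum (range A.numVars) (A.countPoly G) x = (tupleCount A.pat (A.κ + 1) G : R) := by
  classical
  rw [tupleCount, Nat.card_eq_fintype_card, Fintype.card_subtype, ← sum_boole, cubeSum]
  refine (sum_of_injOn A.tupleCode A.tupleCode_injective.injOn (fun φ _ => ?_)
    (fun S hS hnot => ?_) fun φ _ => (A.countPoly_tuplePoint G φ x).symm).symm
  · exact mem_coe.2 (mem_powerset.2 (filter_subset _ _))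
  · obtain ⟨i, hi⟩ : ∃ i : Fin (A.κ + 1), ∀ u : Fin n,
        ¬ ∀ b < A.m, (u : ℕ).testBit b ↔ i * A.m + b ∈ S := by
      by_contra! h
      obtain ⟨φ, hφ⟩ := A.exists_tupleCode_eq (mem_powerset.1 hS) h
      exact hnot ⟨φ, mem_coe.2 (mem_univ φ), hφ⟩
    refine A.countPoly_eq_zero G (i := i) fun u => ?_
    rw [bitsIndicator_cubePoint fun b hb => mem_range.2 (A.lt_numVars (Nat.lt_succ_iff.1 i.2) hb),
      if_neg (hi u)]

/-! ### The polynomials of the sumcheck protocol -/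

/-- The univariate function that the prover has to send in round `t`, at the point `x`. In the last
round `t = A.numVars` the factors are randomized by the masks `μ`. -/
def roundFun (μ : ℕ → R) (t : ℕ) (x : ℕ → R) (z : R) : R :=
  if t < A.numVars then cubeSum (Ico (t + 1) A.numVars) (A.countPoly G) (update x t z)
  else ∏ i ∈ range A.κ, (A.factor G (i + 1) x + z * μ i)

/-- The combination of the values of the function of round `t` that is compared with the value of
the function of round `t - 1`. -/
def checkSum (t : ℕ) (g : R → R) : R := g 0 + if t < A.numVars then g 1 else 0

variable (μ : ℕ → R)

lemma hasDegreeLE_roundFun (t : ℕ) : HasDegreeLE A.κ (A.roundFun G μ t x) := by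
  unfold roundFun
  split_ifs with ht
  · exact (A.coordDegreeLE_countPoly G t).cubeSum (by simp) x
  · refine (HasDegreeLE.prod (d := fun _ => 1) (range A.κ) fun i _ =>
      (HasDegreeLE.const _).add (HasDegreeLE.id.mul (HasDegreeLE.const (d := 0) (μ i)))).mono ?_
    simp

lemma roundFun_numVars (z : R) :
    A.roundFun G μ A.numVars x z = ∏ i ∈ range A.κ, (A.factor G (i + 1) x + z * μ i) :=
  if_neg (lt_irrefl _)

lemma checkSum_roundFun {t : ℕ} (ht : t ≤ A.numVars) :
    A.checkSum t (A.roundFun G μ t x) = cubeSum (Ico t A.numVars) (A.countPoly G) x := by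
  rcases ht.lt_or_eq with ht | rfl
  · rw [← insert_Ico_add_one_left_eq_Ico ht, cubeSum_insert (by simp)]
    simp only [checkSum, roundFun, ht, if_true]
  · simp [checkSum, roundFun_numVars, cubeSum_empty, countPoly]

lemma checkSum_roundFun_zero :
    A.checkSum 0 (A.roundFun G μ 0 x) = (tupleCount A.pat (A.κ + 1) G : R) := by
  rw [A.checkSum_roundFun G x μ (Nat.zero_le _), ← range_eq_Ico, cubeSum_countPoly]

lemma checkSum_roundFun_succ {t : ℕ} (ht : t < A.numVars) :
    A.checkSum (t + 1) (A.roundFun G μ (t + 1) x) = A.roundFun G μ t x (x t) := by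
  rw [A.checkSum_roundFun G x μ ht, roundFun, if_pos ht, update_eq_self]

variable {x μ} in
lemma roundFun_congr {t : ℕ} {y ν : ℕ → R} (hxy : ∀ i < t, x i = y i)
    (hμν : A.numVars ≤ t → ∀ i < A.κ, μ i = ν i) (z : R) :
    A.roundFun G μ t x z = A.roundFun G ν t y z := by
  unfold roundFun
  split_ifs with ht
  · refine cubeSum_congr (fun _ _ => countPoly_congr G) fun i hi hnot => ?_
    rcases eq_or_ne i t with rfl | hit
    · simp
    · simp only [update_of_ne hit]
      exact hxy i (by simp only [mem_range, mem_Ico] at hi hnot; omega)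
  · refine prod_congr rfl fun i hi => ?_
    have hiκ := mem_range.1 hi
    rw [factor_congr G hiκ fun j hj => hxy j (by have := mem_range.1 hj; omega),
      hμν (by omega) i hiκ]

end CountingScheme
end Arithmetization

/-! ### The equations of the protocol -/

/-- A message of the prover to one node. Coefficient `j` of a round polynomial is the sum of the
entry `coeff` of node `j` and the entry `coeff'` of its predecessor in the cyclic order, and a mask
is the sum of the entries `maskShare` of all nodes. The entry `treeValue` is the mask of the node in
the first message and the masked sum over its subtree in the last one. -/
structure ProverMsg (F : Type) where
  coin : F
  coeff : F
  coeff' : F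
  maskShare : F
  maskedFactor : F
  treeValue : F

instance {F : Type} [Zero F] : Zero (ProverMsg F) := ⟨⟨0, 0, 0, 0, 0, 0⟩⟩

/-- The messages of the prover to one node, in the order of the rounds. -/
abbrev Messages (F : Type) : Type := ℕ → ProverMsg F

section Equations

variable {F : Type} [Field F] {n : ℕ}

open Classical in
/-- The evaluation point of the randomized product: with the coin `0` the masked factors would not
be masked. -/
def replaceZero (z : F) : F := if z = 0 then 1 else z

lemma replaceZero_ne_zero (z : F) : replaceZero z ≠ 0 := by
  unfold replaceZero
  split_ifs with h
  · exact one_ne_zero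
  · exact h

/-- The part of the polynomial of round `t` that node `u` knows. -/
def share (u : Fin n) (D : Messages F) (t : ℕ) (z : F) : F :=
  (D t).coeff * z ^ (u : ℕ) + (D t).coeff' * z ^ (finRotate n u : ℕ)

/-- The polynomial of round `t` that is shared by the nodes. -/
def sharedFun (D : Fin n → Messages F) (t : ℕ) (z : F) : F := ∑ u, share u (D u) t z

/-- The masks that are shared by the nodes. -/
def sharedMask (D : Fin n → Messages F) (i : ℕ) : F := ∑ u, (D u i).maskShare

lemma sharedFun_eq (D : Fin n → Messages F) (t : ℕ) (z : F) :
    sharedFun D t z =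
      ∑ j, ((D j t).coeff + (D ((finRotate n).symm j) t).coeff') * z ^ (j : ℕ) := by
  simp only [sharedFun, share, sum_add_distrib, add_mul]
  congr 1
  rw [← Equiv.sum_comp (finRotate n) fun j => (D ((finRotate n).symm j) t).coeff' * z ^ (j : ℕ)]
  simp only [Equiv.symm_apply_apply]

lemma hasDegreeLE_sharedFun (D : Fin n → Messages F) (t : ℕ) :
    HasDegreeLE (n - 1) (sharedFun D t) := by
  rw [funext (sharedFun_eq D t)]
  exact HasDegreeLE.sum_mul_pow _

namespace CountingScheme

variable (A : CountingScheme n)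

lemma sum_checkSum_share (D : Fin n → Messages F) (j t : ℕ) :
    ∑ u, A.checkSum j (share u (D u) t) = A.checkSum j (sharedFun D t) := by
  unfold checkSum sharedFun
  split_ifs <;> simp only [add_zero, sum_add_distrib]

/-- The `i`-th masked factor. -/
def maskedFactor (D : Messages F) (i : ℕ) : F := (D (A.numVars + 1 + i)).maskedFactor

/-- The point of the sumcheck protocol given by the public coins `c`: coin `t + 1` is drawn between
the messages `t` and `t + 1`. -/
def sumcheckPoint (c : ℕ → F) : ℕ → F := fun t => c (t + 1)

/-- The point at which the randomized product of the factors is evaluated. -/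
def maskPoint (c : ℕ → F) : F := replaceZero (c (A.numVars + 1))

/-- The point at which the polynomial of round `t` is evaluated. -/
def evalPoint (c : ℕ → F) (t : ℕ) : F := if t < A.numVars then c (t + 1) else A.maskPoint c

/-- The equations of the protocol, for the public coins `c`. -/
structure EquationsHold [NeZero n] (G : SimpleGraph (Fin n)) (c : ℕ → F) (claim : F)
    (D : Fin n → Messages F) : Prop where
  start : A.checkSum 0 (sharedFun D 0) = claim
  round : ∀ t < A.numVars,
    A.checkSum (t + 1) (sharedFun D (t + 1)) = sharedFun D t (sumcheckPoint c t)
  product : sharedFun D A.numVars (A.maskPoint c) = ∏ i ∈ range A.κ, A.maskedFactor (D 0) i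
  factor : ∀ i < A.κ, A.maskedFactor (D 0) i =
    A.factor G (i + 1) (sumcheckPoint c) + A.maskPoint c * sharedMask D i

/-- The polynomial of round `t` is not the right one, but has the right value at the point at which
it is evaluated. -/
structure BadRound (G : SimpleGraph (Fin n)) (c : ℕ → F) (D : Fin n → Messages F) (t : ℕ) :
    Prop where
  ne : sharedFun D t ≠ A.roundFun G (sharedMask D) t (sumcheckPoint c)
  eval_eq : sharedFun D t (A.evalPoint c t) =
    A.roundFun G (sharedMask D) t (sumcheckPoint c) (A.evalPoint c t)

variable {A} {G : SimpleGraph (Fin n)} {c : ℕ → F} {claim : F} {D : Fin n → Messages F}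
  [NeZero n]

lemma EquationsHold.of_sharedFun_eq (hclaim : claim = (tupleCount A.pat (A.κ + 1) G : F))
    (hfun : ∀ t ≤ A.numVars,
      sharedFun D t = A.roundFun G (sharedMask D) t (sumcheckPoint c))
    (hfactor : ∀ i < A.κ, A.maskedFactor (D 0) i =
      A.factor G (i + 1) (sumcheckPoint c) + A.maskPoint c * sharedMask D i) :
    A.EquationsHold G c claim D where
  start := by rw [hfun 0 (Nat.zero_le _), checkSum_roundFun_zero, hclaim]
  round t ht := by rw [hfun (t + 1) ht, checkSum_roundFun_succ _ _ _ _ ht, hfun t ht.le]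
  product := by
    rw [hfun _ le_rfl, roundFun_numVars]
    exact prod_congr rfl fun i hi => (hfactor i (mem_range.1 hi)).symm
  factor := hfactor

/-- An error in the claim propagates from round to round, and contradicts the equations for the
factors at the end. -/
lemma EquationsHold.claim_eq (h : A.EquationsHold G c claim D)
    (hbad : ∀ t ≤ A.numVars, ¬ A.BadRound G c D t) :
    claim = (tupleCount A.pat (A.κ + 1) G : F) := by
  by_contra hne
  have sharedFun_ne : ∀ t ≤ A.numVars,
      sharedFun D t ≠ A.roundFun G (sharedMask D) t (sumcheckPoint c) := by
    intro t
    induction t with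
    | zero =>
      intro _ heq
      exact hne (by rw [← h.start, heq, checkSum_roundFun_zero])
    | succ t ih =>
      intro ht heq
      have hround := h.round t ht
      rw [heq, checkSum_roundFun_succ _ _ _ _ ht] at hround
      refine hbad t (Nat.le_of_succ_le ht) ⟨ih (Nat.le_of_succ_le ht), ?_⟩
      rw [evalPoint, if_pos (Nat.lt_of_succ_le ht)]
      exact hround.symm
  refine hbad A.numVars le_rfl ⟨sharedFun_ne _ le_rfl, ?_⟩
  rw [evalPoint, if_neg (lt_irrefl _), h.product, roundFun_numVars]
  exact prod_congr rfl fun i hi => h.factor i (mem_range.1 hi)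

variable (A) in
/-- The contribution of node `u`, with adjacency row `row`, to the `j`-th equation. -/
def eqnTerm (c : ℕ → F) (claim : F) (u : Fin n) (row : Fin n → Bool) (D : Messages F) (j : ℕ) :
    F :=
  if j = 0 then A.checkSum 0 (share u D 0) - if u = 0 then claim else 0
  else if j ≤ A.numVars then
    A.checkSum j (share u D j) - share u D (j - 1) (sumcheckPoint c (j - 1))
  else if j = A.numVars + 1 then
    share u D A.numVars (A.maskPoint c) - if u = 0 then ∏ i ∈ range A.κ, A.maskedFactor D i else 0
  else
    let i := j - (A.numVars + 2)
    A.nodeTerm (i + 1) u row (sumcheckPoint c) + A.maskPoint c * (D i).maskShare -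
      if u = 0 then A.maskedFactor D i else 0

lemma sum_eqnTerm_zero (row : Fin n → Fin n → Bool) :
    ∑ u, A.eqnTerm c claim u (row u) (D u) 0 = A.checkSum 0 (sharedFun D 0) - claim := by
  simp only [eqnTerm, if_true, sum_sub_distrib, sum_checkSum_share, sum_ite_eq', mem_univ]

lemma sum_eqnTerm_succ (row : Fin n → Fin n → Bool) {t : ℕ} (ht : t < A.numVars) :
    ∑ u, A.eqnTerm c claim u (row u) (D u) (t + 1) =
      A.checkSum (t + 1) (sharedFun D (t + 1)) - sharedFun D t (sumcheckPoint c t) := by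
  simp only [eqnTerm, Nat.succ_ne_zero, if_false, Nat.succ_le_of_lt ht, if_true, sum_sub_distrib,
    sum_checkSum_share, Nat.add_sub_cancel]
  rfl

lemma sum_eqnTerm_product (row : Fin n → Fin n → Bool) :
    ∑ u, A.eqnTerm c claim u (row u) (D u) (A.numVars + 1) =
      sharedFun D A.numVars (A.maskPoint c) - ∏ i ∈ range A.κ, A.maskedFactor (D 0) i := by
  simp only [eqnTerm, Nat.succ_ne_zero, if_false, Nat.not_succ_le_self, if_true, sum_sub_distrib,
    sum_ite_eq', mem_univ]
  rfl

lemma sum_eqnTerm_factor (i : ℕ) :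
    ∑ u, A.eqnTerm c claim u (adjRow G u) (D u) (A.numVars + 2 + i) =
      A.factor G (i + 1) (sumcheckPoint c) + A.maskPoint c * sharedMask D i -
        A.maskedFactor (D 0) i := by
  have h0 : A.numVars + 2 + i ≠ 0 := by omega
  have h1 : ¬ A.numVars + 2 + i ≤ A.numVars := by omega
  have h2 : A.numVars + 2 + i ≠ A.numVars + 1 := by omega
  simp only [eqnTerm, h0, h1, h2, if_false, Nat.add_sub_cancel_left, sum_sub_distrib,
    sum_add_distrib, ← mul_sum, sum_ite_eq', mem_univ, if_true]
  rfl

lemma equationsHold_iff :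
    A.EquationsHold G c claim D ↔
      ∀ j < A.numMsgs, ∑ u, A.eqnTerm c claim u (adjRow G u) (D u) j = 0 := by
  have numMsgs_eq : A.numMsgs = A.numVars + A.κ + 2 := rfl
  constructor
  · intro h j hj
    rcases Nat.eq_zero_or_pos j with rfl | hpos
    · rw [sum_eqnTerm_zero, h.start, sub_self]
    by_cases hround : j ≤ A.numVars
    · obtain ⟨t, rfl⟩ := Nat.exists_eq_succ_of_ne_zero hpos.ne'
      rw [sum_eqnTerm_succ _ hround, h.round t hround, sub_self]
    by_cases hproduct : j = A.numVars + 1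
    · rw [hproduct, sum_eqnTerm_product, h.product, sub_self]
    · obtain ⟨i, rfl⟩ : ∃ i, j = A.numVars + 2 + i := ⟨j - (A.numVars + 2), by omega⟩
      rw [sum_eqnTerm_factor, h.factor i (by omega), sub_self]
  · intro h
    refine ⟨?_, fun t ht => ?_, ?_, fun i hi => ?_⟩ <;> rw [← sub_eq_zero]
    · rw [← h 0 (by omega), sum_eqnTerm_zero]
    · rw [← h (t + 1) (by omega), sum_eqnTerm_succ _ ht]
    · rw [← h (A.numVars + 1) (by omega), sum_eqnTerm_product]
    · rw [← neg_eq_zero, neg_sub, ← h (A.numVars + 2 + i) (by omega), sum_eqnTerm_factor]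

end CountingScheme

end Equations

/-! ### The verifier -/

/-- An encoding of the elements of `X` by `ℓ` bits. -/
structure Codec (X : Type) (ℓ : ℕ) where
  enc : X → Msg ℓ
  dec : Msg ℓ → X
  dec_enc : ∀ x, dec (enc x) = x

lemma exists_codec {F X : Type} [Fintype F] [Nonempty X] {s w : ℕ} {f : X → Fin w → F}
    (hf : Injective f) (hF : Fintype.card F ≤ 2 ^ s) : Nonempty (Codec X (w * s)) := by
  classical
  have card_le : Fintype.card (Fin w → F) ≤ Fintype.card (Msg (w * s)) := by
    simp only [Fintype.card_fun, Fintype.card_fin, Fintype.card_bool]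
    rw [mul_comm, pow_mul]
    exact Nat.pow_le_pow_left hF w
  obtain ⟨e⟩ := Embedding.nonempty_of_card_le card_le
  have he : Injective (e ∘ f) := e.injective.comp hf
  exact ⟨⟨e ∘ f, invFun (e ∘ f), leftInverse_invFun he⟩⟩

/-- A message between neighbours in the verification phase. -/
structure NodeMsg (F : Type) where
  subtreeSum : F
  lastCoin : F
  fingerprint : F
  claim : F

/-- The nodes other than the root with parent `v`. -/
def Network.children {n : ℕ} [NeZero n] {Λ : Type} (N : Network n Λ) (v : Fin n) :
    Finset (Fin n) := {u ∈ univ.erase 0 | N.parent u = v}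

lemma Network.sum_children {n : ℕ} [NeZero n] {Λ : Type} {M : Type*} [AddCommGroup M]
    (N : Network n Λ) (f : Fin n → M) : ∑ v, ∑ u ∈ N.children v, f u = ∑ u, f u - f 0 := by
  simp only [Network.children]
  rw [sum_fiberwise, sum_erase_eq_sub (mem_univ _)]

lemma Network.mem_children_iff {n : ℕ} [NeZero n] {Λ : Type} {N : Network n Λ} {u v : Fin n} :
    u ∈ N.children v ↔ N.graph.Adj u v ∧ v = N.parent u := by
  simp only [Network.children, mem_filter, mem_erase, mem_univ, and_true]
  constructor
  · rintro ⟨hu, rfl⟩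
    exact ⟨N.adj_parent u (Fin.val_ne_zero_iff.2 hu), rfl⟩
  · rintro ⟨hadj, rfl⟩
    refine ⟨?_, rfl⟩
    rintro rfl
    exact hadj.ne (N.parent_root 0 rfl).symm

/-- A finite sequence of coins, continued by zeros. -/
def padZero {F : Type} [Zero F] {R : ℕ} (c : Fin R → F) (t : ℕ) : F :=
  if h : t < R then c ⟨t, h⟩ else 0

section Verifier

variable {F : Type} [Field F] {n ℓ b : ℕ}

/-- The sequence of messages contained in a list of bit strings, continued by zeros. -/
def decodeList (C : Codec (ProverMsg F) ℓ) (L : List (Msg ℓ)) : Messages F :=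
  fun t => (L.map C.dec).getD t 0

namespace CountingScheme

variable (A : CountingScheme n)

/-- The public coins other than the last one, as coefficients of a polynomial, evaluated at `z`. -/
def fingerprint (c : ℕ → F) (z : F) : F := ∑ t ∈ range A.lastMsg, c t * z ^ t

/-- The public coins received by a node. -/
def coinsOf (D : Messages F) : ℕ → F := fun t => (D t).coin

/-- The number of tuples that corresponds to the label `Δ`. -/
def claimOf (F : Type) [Field F] (Δ : ℕ) : F := ((Δ * A.aut : ℕ) : F)

/-- The message of a node to its neighbour `v`. -/
def nodeMsg (inp : LocalInput n ℕ) (D : Messages F) (v : Fin n) : NodeMsg F where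
  subtreeSum := if v = inp.parent then (D A.lastMsg).treeValue else 0
  lastCoin := (D A.lastMsg).coin
  fingerprint := A.fingerprint (coinsOf D) (D A.lastMsg).coin
  claim := A.claimOf F inp.label

open Classical in
/-- The messages that node `v` receives from its neighbours. -/
def inbox (N : Network n ℕ) (D : Fin n → Messages F) (v : Fin n) : Fin n → Option (NodeMsg F) :=
  fun u => if N.graph.Adj u v then some (A.nodeMsg (N.input u) (D u) v) else none

lemma mem_inbox {N : Network n ℕ} {D : Fin n → Messages F} {u v : Fin n} {x : NodeMsg F} :
    x ∈ A.inbox N D v u ↔ N.graph.Adj u v ∧ A.nodeMsg (N.input u) (D u) v = x := by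
  simp [inbox]

lemma isSome_inbox (N : Network n ℕ) (D : Fin n → Messages F) (v : Fin n) :
    (fun u => (A.inbox N D v u).isSome) = adjRow N.graph v := by
  funext u
  by_cases h : N.graph.Adj u v
  · simp [inbox, adjRow, h, h.symm]
  · simp [inbox, adjRow, h, N.graph.adj_comm v u]

variable [NeZero n]

/-- The sum of the equation terms of a node, weighted by powers of the last coin. -/
def localSum (c : ℕ → F) (claim : F) (u : Fin n) (row : Fin n → Bool) (D : Messages F) : F :=
  ∑ j ∈ range A.numMsgs, c A.lastMsg ^ (j + 1) * A.eqnTerm c claim u row D j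

/-- The condition under which a node accepts. -/
structure NodeAccepts (inp : LocalInput n ℕ) (coin : ℕ → F) (D : Messages F)
    (inbox : Fin n → Option (NodeMsg F)) : Prop where
  label_le : inp.label * A.aut ≤ A.bound
  root_coin : inp.id = 0 → ∀ t < A.numMsgs, (D t).coin = coin t
  root_sum : inp.id = 0 → (D A.lastMsg).treeValue = 0
  lastCoin_eq : ∀ u, ∀ x ∈ inbox u, x.lastCoin = (D A.lastMsg).coin
  fingerprint_eq : ∀ u, ∀ x ∈ inbox u,
    x.fingerprint = A.fingerprint (coinsOf D) (D A.lastMsg).coin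
  claim_eq : ∀ u, ∀ x ∈ inbox u, x.claim = A.claimOf F inp.label
  sum_eq : (D A.lastMsg).treeValue = (D 0).treeValue +
    A.localSum (coinsOf D) (A.claimOf F inp.label) inp.id (fun u => (inbox u).isSome) D +
      ∑ u, (inbox u).elim 0 NodeMsg.subtreeSum

open Classical in
/-- The verifier. The coins of the root are public, and the other nodes do not use their coins. -/
def verifier [Fintype F] (C : Codec (ProverMsg F) ℓ) (C' : Codec (NodeMsg F) b) :
    Verifier n ℓ b ℕ where
  Coin := Fin A.numMsgs → F
  respond inp coin L :=
    C.enc { (0 : ProverMsg F) with coin := if inp.id = 0 then padZero coin L.length else 0 }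
  verify :=
    { send := fun d _ v => C'.enc (A.nodeMsg d.1 (decodeList C d.2.2) v)
      out := fun d L => decide (A.NodeAccepts d.1 (padZero d.2.1) (decodeList C d.2.2)
        fun u => (L.headD (fun _ => none) u).map C'.dec) }

lemma verify_out_iff [Fintype F] (C : Codec (ProverMsg F) ℓ) (C' : Codec (NodeMsg F) b)
    (d : LocalInput n ℕ × (Fin A.numMsgs → F) × List (Msg ℓ)) (f : Fin n → Option (NodeMsg F)) :
    (A.verifier C C').verify.out d [fun u => (f u).map C'.enc] = true ↔
      A.NodeAccepts d.1 (padZero d.2.1) (decodeList C d.2.2) f := by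
  have dec_f : (fun u => ((f u).map C'.enc).map C'.dec) = f := by
    funext u
    rw [Option.map_map, show C'.dec ∘ C'.enc = id from funext C'.dec_enc, Option.map_id, id]
  conv_rhs => rw [← dec_f]
  exact @decide_eq_true_iff _ (Classical.propDecidable _)

/-- The condition under which all nodes accept, if the root has drawn the coins `c` and node `v` has
received the messages `D v`. -/
structure Accepts (N : Network n ℕ) (c : ℕ → F) (D : Fin n → Messages F) : Prop where
  label_le : ∀ v, N.label v * A.aut ≤ A.bound
  root_coin : ∀ t < A.numMsgs, (D 0 t).coin = c t
  root_sum : (D 0 A.lastMsg).treeValue = 0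
  lastCoin_eq : ∀ u v, N.graph.Adj u v → (D u A.lastMsg).coin = (D v A.lastMsg).coin
  fingerprint_eq : ∀ u v, N.graph.Adj u v →
    A.fingerprint (coinsOf (D u)) (D u A.lastMsg).coin =
      A.fingerprint (coinsOf (D v)) (D v A.lastMsg).coin
  claim_eq : ∀ u v, N.graph.Adj u v → A.claimOf F (N.label u) = A.claimOf F (N.label v)
  sum_eq : ∀ v, (D v A.lastMsg).treeValue = (D v 0).treeValue +
    A.localSum (coinsOf (D v)) (A.claimOf F (N.label v)) v (adjRow N.graph v) (D v) +
      ∑ u ∈ N.children v, (D u A.lastMsg).treeValue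

lemma sum_inbox (N : Network n ℕ) (D : Fin n → Messages F) (v : Fin n) :
    ∑ u, (A.inbox N D v u).elim 0 NodeMsg.subtreeSum =
      ∑ u ∈ N.children v, (D u A.lastMsg).treeValue := by
  classical
  rw [← univ_inter (N.children v), ← sum_ite_mem]
  refine sum_congr rfl fun u _ => ?_
  by_cases hadj : N.graph.Adj u v
  · simp only [inbox, nodeMsg, Network.input, Network.mem_children_iff, hadj, if_true, true_and,
      Option.elim]
    exact if_congr Iff.rfl rfl rfl
  · simp only [inbox, Network.mem_children_iff, hadj, if_false, false_and, Option.elim]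

lemma forall_nodeAccepts_iff (N : Network n ℕ) (coin : Fin n → ℕ → F) (D : Fin n → Messages F) :
    (∀ v, A.NodeAccepts (N.input v) (coin v) (D v) (A.inbox N D v)) ↔
      A.Accepts N (coin 0) D := by
  constructor
  · intro h
    have mem {u v : Fin n} (huv : N.graph.Adj u v) := (A.mem_inbox (D := D)).2 ⟨huv, rfl⟩
    refine ⟨fun v => (h v).label_le, (h 0).root_coin rfl, (h 0).root_sum rfl,
      fun u v huv => (h v).lastCoin_eq u _ (mem huv),
      fun u v huv => (h v).fingerprint_eq u _ (mem huv),
      fun u v huv => (h v).claim_eq u _ (mem huv), fun v => ?_⟩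
    rw [(h v).sum_eq, isSome_inbox, sum_inbox]
    rfl
  · refine fun h v => ⟨h.label_le v, ?_, ?_, ?_, ?_, ?_, ?_⟩
    · rintro rfl
      exact h.root_coin
    · rintro rfl
      exact h.root_sum
    · rintro u x hx
      obtain ⟨huv, rfl⟩ := A.mem_inbox.1 hx
      exact h.lastCoin_eq u v huv
    · rintro u x hx
      obtain ⟨huv, rfl⟩ := A.mem_inbox.1 hx
      exact h.fingerprint_eq u v huv
    · rintro u x hx
      obtain ⟨huv, rfl⟩ := A.mem_inbox.1 hx
      exact h.claim_eq u v huv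
    · rw [isSome_inbox, sum_inbox]
      exact h.sum_eq v

end CountingScheme

/-! ### The interaction -/

lemma interact_eq {Λ : Type} {V : Verifier n ℓ b Λ} {P : Prover n ℓ} {N : Network n Λ} {R : ℕ}
    {ω : Randomness V P} {resp : ℕ → Fin n → Msg ℓ}
    (hresp : ∀ v L, V.respond (N.input v) (ω.2 v) L = resp L.length v) :
    ∀ j ≤ R, interact V P N (2 * R) ω (2 * j) =
      ⟨fun v => (List.range j).map fun t => P.strategy ω.1 ((List.range (t + 1)).map resp) v,
        (List.range j).map resp⟩ := by
  intro j
  induction j with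
  | zero => intro _; rfl
  | succ j ih =>
    intro hj
    have node_round : ¬ Odd (2 * R - 2 * j) := by
      rw [← Nat.mul_sub]
      exact Nat.not_odd_iff_even.2 (even_two_mul _)
    have prover_round : Odd (2 * R - (2 * j + 1)) := ⟨R - j - 1, by omega⟩
    have after_node_round : interact V P N (2 * R) ω (2 * j + 1) =
        ⟨fun v => (List.range j).map fun t => P.strategy ω.1 ((List.range (t + 1)).map resp) v,
          (List.range (j + 1)).map resp⟩ := by
      rw [interact, ih (by omega), if_neg node_round]
      simp only [hresp, List.length_map, List.length_range, List.range_succ, List.map_append,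
        List.map_cons, List.map_nil]
    rw [show 2 * (j + 1) = 2 * j + 1 + 1 by ring, interact, after_node_round, if_pos prover_round]
    simp only [List.range_succ, List.map_append, List.map_cons, List.map_nil]

variable [NeZero n]

/-- The answers of the nodes in round `t`, for the public coins `c`. -/
def respAt (C : Codec (ProverMsg F) ℓ) (c : ℕ → F) (t : ℕ) : Fin n → Msg ℓ :=
  fun v => C.enc { (0 : ProverMsg F) with coin := if v = 0 then c t else 0 }

namespace CountingScheme

variable (A : CountingScheme n) (C : Codec (ProverMsg F) ℓ) (P : Prover n ℓ)

/-- The messages of a prover, for the public coins `c`. -/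
def messagesOf (seed : P.Seed) (c : ℕ → F) : Fin n → Messages F := fun v t =>
  if t < A.numMsgs then C.dec (P.strategy seed ((List.range (t + 1)).map (respAt C c)) v) else 0

/-- The messages up to number `t` depend only on the coins up to number `t`. -/
def IsCausal (D : (ℕ → F) → Fin n → Messages F) : Prop :=
  ∀ ⦃c c' : ℕ → F⦄ ⦃t : ℕ⦄, (∀ i ≤ t, c i = c' i) → ∀ v, D c v t = D c' v t

lemma isCausal_messagesOf (seed : P.Seed) : IsCausal (A.messagesOf C P seed) := by
  intro c c' t h v
  have map_eq : (List.range (t + 1)).map (respAt (n := n) C c) =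
      (List.range (t + 1)).map (respAt C c') :=
    List.map_congr_left fun i hi => by
      unfold respAt
      rw [h i (Nat.lt_succ_iff.1 (List.mem_range.1 hi))]
  simp only [messagesOf, map_eq]

variable [Fintype F] (C' : Codec (NodeMsg F) b) (N : Network n ℕ)
  (ω : Randomness (A.verifier C C') P)

lemma toNode_interact (v : Fin n) :
    (interact (A.verifier C C') P N (2 * A.numMsgs) ω (2 * A.numMsgs)).toNode v =
      (List.range A.numMsgs).map fun t =>
        P.strategy ω.1 ((List.range (t + 1)).map (respAt C (padZero (ω.2 0)))) v := by
  rw [interact_eq (resp := respAt C (padZero (ω.2 0))) (fun v L => ?_) A.numMsgs le_rfl]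
  simp only [verifier, respAt, Network.input]
  congr 2
  exact if_ctx_congr Iff.rfl (fun hv => by rw [hv]) fun _ => rfl

lemma decodeList_toNode (v : Fin n) :
    decodeList C ((interact (A.verifier C C') P N (2 * A.numMsgs) ω (2 * A.numMsgs)).toNode v) =
      A.messagesOf C P ω.1 (padZero (ω.2 0)) v := by
  rw [toNode_interact]
  funext t
  by_cases ht : t < A.numMsgs <;> simp [decodeList, messagesOf, ht, List.getD]

lemma received_verifier (v : Fin n) :
    (A.verifier C C').verify.received N.graph
        (verifyInput (A.verifier C C') P N (2 * A.numMsgs) ω) 1 v =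
      [fun u => (A.inbox N (A.messagesOf C P ω.1 (padZero (ω.2 0))) v u).map C'.enc] := by
  simp only [LocalAlg.received, List.nil_append]
  congr 1
  funext u
  unfold inbox
  split_ifs
  · rw [← A.decodeList_toNode C P C' N ω u]
    rfl
  · rfl

lemma allAccept_iff :
    AllAccept (A.verifier C C') P N (2 * A.numMsgs) 1 ω ↔
      A.Accepts N (padZero (ω.2 0)) (A.messagesOf C P ω.1 (padZero (ω.2 0))) := by
  rw [← A.forall_nodeAccepts_iff N fun v => padZero (ω.2 v)]
  refine forall_congr' fun v => ?_
  rw [LocalAlg.run, received_verifier, ← A.decodeList_toNode C P C' N ω v]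
  exact A.verify_out_iff C C' _ _

end CountingScheme

end Verifier

/-! ### Soundness -/

lemma eq_of_connected {V α : Type*} {G : SimpleGraph V} (hG : G.Connected) {f : V → α}
    (h : ∀ u v, G.Adj u v → f u = f v) (u v : V) : f u = f v := by
  obtain ⟨p⟩ := hG.preconnected u v
  induction p with
  | nil => rfl
  | cons hadj _ ih => exact (h _ _ hadj).trans ih

section BadEvents

variable {F : Type} [Field F] {n : ℕ}

namespace CountingScheme

variable (A : CountingScheme n)

/-- Some public coin received by a node is wrong, but all of them have the right fingerprint. -/
structure BadFingerprint (c : ℕ → F) (D : Messages F) : Prop where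
  exists_ne : ∃ t < A.lastMsg, (D t).coin ≠ c t
  eq : A.fingerprint (coinsOf D) (c A.lastMsg) = A.fingerprint c (c A.lastMsg)

variable {A}

lemma κ_le_numVars : A.κ ≤ A.numVars :=
  (Nat.le_succ _).trans (Nat.le_mul_of_pos_right _ A.m_pos)

variable [NeZero n]

variable (A) in
/-- Some equation is violated, but the weighted sum of all equations is satisfied. -/
structure BadBatch (G : SimpleGraph (Fin n)) (c : ℕ → F) (claim : F) (D : Fin n → Messages F) :
    Prop where
  not_equationsHold : ¬ A.EquationsHold G c claim D
  sum_eq_zero : ∑ u, (D u 0).treeValue + ∑ u, A.localSum c claim u (adjRow G u) (D u) = 0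

lemma eqnTerm_congr {c c' : ℕ → F} (claim : F) (u : Fin n) (row : Fin n → Bool)
    {D D' : Messages F} (hc : ∀ t < A.lastMsg, c t = c' t) (hD : ∀ t < A.lastMsg, D t = D' t)
    {j : ℕ} (hj : j < A.numMsgs) :
    A.eqnTerm c claim u row D j = A.eqnTerm c' claim u row D' j := by
  have κ_pos := A.κ_pos
  have lastMsg_eq : A.lastMsg = A.numVars + A.κ + 1 := rfl
  have numMsgs_eq : A.numMsgs = A.lastMsg + 1 := rfl
  have share_eq : ∀ t ≤ A.numVars, share u D t = share u D' t := fun t ht => by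
    funext z
    rw [share, share, hD t (by omega)]
  have maskedFactor_eq : ∀ i < A.κ, A.maskedFactor D i = A.maskedFactor D' i := fun i hi => by
    rw [maskedFactor, maskedFactor, hD _ (by omega)]
  have maskPoint_eq : A.maskPoint c = A.maskPoint c' := by
    rw [maskPoint, maskPoint, hc _ (by omega)]
  unfold eqnTerm
  split_ifs with h_start h_root h_round h_product h_root
  · rw [share_eq 0 (by omega)]
  · rw [share_eq 0 (by omega)]
  · rw [share_eq j h_round, share_eq (j - 1) (by omega), sumcheckPoint, sumcheckPoint,
      hc _ (by omega)]
  · rw [share_eq _ le_rfl, maskPoint_eq,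
      prod_congr rfl fun i hi => maskedFactor_eq i (mem_range.1 hi)]
  · rw [share_eq _ le_rfl, maskPoint_eq]
  all_goals
    have hi : j - (A.numVars + 2) < A.κ := by omega
    have nodeTerm_eq := A.nodeTerm_congr (i := j - (A.numVars + 2) + 1) hi u row
      (x := sumcheckPoint c) (y := sumcheckPoint c')
      fun t ht => hc (t + 1) (by have := mem_range.1 ht; omega)
    simp only [nodeTerm_eq, maskPoint_eq, hD _ (show j - (A.numVars + 2) < A.lastMsg by omega),
      maskedFactor_eq _ hi]

lemma localSum_congr {c c' : ℕ → F} (hc : ∀ t < A.numMsgs, c t = c' t) (claim : F) (u : Fin n)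
    (row : Fin n → Bool) (D : Messages F) :
    A.localSum c claim u row D = A.localSum c' claim u row D := by
  refine sum_congr rfl fun j hj => ?_
  rw [hc _ A.lastMsg_lt, eqnTerm_congr claim u row
    (fun t ht => hc t (ht.trans A.lastMsg_lt)) (fun _ _ => rfl) (mem_range.1 hj)]

lemma sum_localSum (G : SimpleGraph (Fin n)) (c : ℕ → F) (claim : F) (D : Fin n → Messages F) :
    ∑ u, A.localSum c claim u (adjRow G u) (D u) =
      ∑ j ∈ range A.numMsgs,
        (∑ u, A.eqnTerm c claim u (adjRow G u) (D u) j) * c A.lastMsg ^ (j + 1) := by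
  unfold localSum
  rw [sum_comm]
  exact sum_congr rfl fun j _ => by rw [← mul_sum, mul_comm]

namespace Accepts

variable {N : Network n ℕ} {c : ℕ → F} {D : Fin n → Messages F}

lemma label_eq (h : A.Accepts N c D)
    (hcast : Set.InjOn (Nat.cast : ℕ → F) (Set.Iic A.bound)) (u v : Fin n) :
    N.label u = N.label v :=
  eq_of_connected N.connected (fun u v huv => Nat.eq_of_mul_eq_mul_right A.aut_pos
    (hcast (h.label_le u) (h.label_le v) (h.claim_eq u v huv))) u v

lemma coin_eq (h : A.Accepts N c D) (hbad : ∀ u, ¬ A.BadFingerprint c (D u)) (u : Fin n) {t : ℕ}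
    (ht : t < A.numMsgs) : (D u t).coin = c t := by
  have lastCoin_eq : ∀ v, (D v A.lastMsg).coin = c A.lastMsg := fun v =>
    (eq_of_connected N.connected h.lastCoin_eq v 0).trans (h.root_coin _ A.lastMsg_lt)
  rcases (Nat.le_of_lt_succ ht).lt_or_eq with ht | rfl
  · by_contra hne
    refine hbad u ⟨⟨t, ht, hne⟩, ?_⟩
    have fingerprint_eq := eq_of_connected N.connected h.fingerprint_eq u 0
    rw [lastCoin_eq, lastCoin_eq] at fingerprint_eq
    rw [fingerprint_eq]
    refine sum_congr rfl fun i hi => ?_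
    rw [coinsOf, h.root_coin i ((mem_range.1 hi).trans A.lastMsg_lt)]
  · exact lastCoin_eq u

lemma sum_eq_zero (h : A.Accepts N c D) (hlabel : ∀ u, N.label u = N.label 0)
    (hcoin : ∀ u, ∀ t < A.numMsgs, (D u t).coin = c t) :
    ∑ u, (D u 0).treeValue +
      ∑ u, A.localSum c (A.claimOf F (N.label 0)) u (adjRow N.graph u) (D u) = 0 := by
  have aggregate : ∑ v, (D v A.lastMsg).treeValue = ∑ v, ((D v 0).treeValue +
      A.localSum c (A.claimOf F (N.label 0)) v (adjRow N.graph v) (D v) +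
        ∑ u ∈ N.children v, (D u A.lastMsg).treeValue) :=
    sum_congr rfl fun v _ => by
      rw [h.sum_eq v, hlabel v, localSum_congr (c := coinsOf (D v)) (hcoin v)]
  rwa [sum_add_distrib, sum_add_distrib, N.sum_children fun u => (D u A.lastMsg).treeValue,
    h.root_sum, sub_zero, right_eq_add] at aggregate

lemma label_mul_aut_eq (h : A.Accepts N c D)
    (hcast : Set.InjOn (Nat.cast : ℕ → F) (Set.Iic A.bound))
    (hround : ∀ t ≤ A.numVars, ¬ A.BadRound N.graph c D t)
    (hfingerprint : ∀ u, ¬ A.BadFingerprint c (D u))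
    (hbatch : ¬ A.BadBatch N.graph c (A.claimOf F (N.label 0)) D) :
    N.label 0 * A.aut = tupleCount A.pat (A.κ + 1) N.graph := by
  have sum_zero := h.sum_eq_zero (fun u => h.label_eq hcast u 0)
    fun u t => h.coin_eq hfingerprint u
  have equations : A.EquationsHold N.graph c (A.claimOf F (N.label 0)) D := by
    by_contra hne
    exact hbatch ⟨hne, sum_zero⟩
  exact hcast (h.label_le 0) (A.tupleCount_le_bound _) (equations.claim_eq hround)

end Accepts

end CountingScheme

end BadEvents

section CausalProver

variable {F : Type} {n : ℕ} {A : CountingScheme n} {D : (ℕ → F) → Fin n → Messages F}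

namespace CountingScheme

lemma IsCausal.update_eq (hD : IsCausal D) (c : ℕ → F) {t τ : ℕ} (ht : t < τ) (z : F)
    (v : Fin n) : D (update c τ z) v t = D c v t :=
  hD (fun _ hi => update_of_ne (hi.trans_lt ht).ne _ _) v

variable [Field F]

lemma evalPoint_update (c : ℕ → F) {t : ℕ} (ht : t ≤ A.numVars) {z : F} (hz : z ≠ 0) :
    A.evalPoint (update c (t + 1) z) t = z := by
  unfold evalPoint maskPoint replaceZero
  rcases ht.lt_or_eq with ht | rfl
  · simp [ht]
  · simp [hz]

variable [Fintype F]

open Classical in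
lemma card_badRound_le (hD : IsCausal D) (G : SimpleGraph (Fin n)) (c : ℕ → F) {t : ℕ}
    (ht : t ≤ A.numVars) :
    #{z | A.BadRound G (update c (t + 1) z) (D (update c (t + 1) z)) t} ≤ n := by
  have κ_lt := A.κ_lt
  set f := sharedFun (D c) t with hf
  set g := A.roundFun G (sharedMask (D c)) t (sumcheckPoint c)
  have sharedFun_eq (z : F) : sharedFun (D (update c (t + 1) z)) t = f := by
    funext y
    simp only [hf, sharedFun, share, hD.update_eq c (Nat.lt_succ_self t)]
  have roundFun_eq (z : F) : A.roundFun G (sharedMask (D (update c (t + 1) z))) t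
      (sumcheckPoint (update c (t + 1) z)) = g := by
    funext y
    refine roundFun_congr A G (fun i hi => ?_) (fun htn i hi => ?_) y
    · rw [sumcheckPoint, sumcheckPoint, update_of_ne (by omega)]
    have hit : i < t + 1 := by have := A.κ_le_numVars; omega
    simp only [sharedMask, hD.update_eq c hit]
  have agree_or_zero : ∀ z, A.BadRound G (update c (t + 1) z) (D (update c (t + 1) z)) t →
      f ≠ g ∧ (z = 0 ∨ f z = g z) := by
    rintro z ⟨hne, heq⟩
    rw [sharedFun_eq, roundFun_eq] at hne heq
    exact ⟨hne, or_iff_not_imp_left.2 fun hz => by rwa [evalPoint_update c ht hz] at heq⟩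
  by_cases hfg : f = g
  · rw [filter_false_of_mem fun z _ hz => (agree_or_zero z hz).1 hfg, card_empty]
    exact Nat.zero_le _
  calc #{z | A.BadRound G (update c (t + 1) z) (D (update c (t + 1) z)) t}
      ≤ #(insert 0 (univ.filter fun z => f z = g z)) := card_le_card fun z hz => by
        simpa using (agree_or_zero z (mem_filter.1 hz).2).2
    _ ≤ #{z | f z = g z} + 1 := card_insert_le _ _
    _ ≤ n - 1 + 1 := Nat.succ_le_succ <| (hasDegreeLE_sharedFun _ _).card_eq_le
        ((A.hasDegreeLE_roundFun G _ _ t).mono (Nat.le_pred_of_lt κ_lt)) hfg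
    _ = n := by omega

open Classical in
lemma card_badFingerprint_le (hD : IsCausal D) (c : ℕ → F) (u : Fin n) :
    #{z | A.BadFingerprint (update c A.lastMsg z) (D (update c A.lastMsg z) u)} ≤ A.numMsgs := by
  have coin_sub_eq_zero : ∀ z, A.BadFingerprint (update c A.lastMsg z)
      (D (update c A.lastMsg z) u) → (∃ t < A.lastMsg, (D c u t).coin - c t ≠ 0) ∧
        ∑ t ∈ range A.lastMsg, ((D c u t).coin - c t) * z ^ t = 0 := by
    rintro z ⟨⟨t, ht, hne⟩, heq⟩
    rw [hD.update_eq c ht, update_of_ne ht.ne] at hne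
    refine ⟨⟨t, ht, sub_ne_zero.2 hne⟩, ?_⟩
    rw [update_self, ← sub_eq_zero, fingerprint, fingerprint, ← sum_sub_distrib] at heq
    rw [← heq]
    refine sum_congr rfl fun i hi => ?_
    have hi := mem_range.1 hi
    rw [coinsOf, hD.update_eq c hi, update_of_ne hi.ne, sub_mul]
  by_cases hcoin : ∃ t < A.lastMsg, (D c u t).coin - c t ≠ 0
  · obtain ⟨t, ht, hne⟩ := hcoin
    have card_roots_le := card_sum_mul_pow_eq_zero_le (a := fun t => (D c u t).coin - c t) ht hne
    refine (card_le_card fun z hz => ?_).trans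
      (card_roots_le.trans ((Nat.sub_le _ _).trans A.lastMsg_lt.le))
    exact mem_filter.2 ⟨mem_univ z, (coin_sub_eq_zero z (mem_filter.1 hz).2).2⟩
  · rw [filter_false_of_mem fun z _ hz => hcoin (coin_sub_eq_zero z hz).1, card_empty]
    exact Nat.zero_le _

open Classical in
lemma card_badBatch_le [NeZero n] (hD : IsCausal D) (G : SimpleGraph (Fin n)) (claim : F)
    (c : ℕ → F) :
    #{z | A.BadBatch G (update c A.lastMsg z) claim (D (update c A.lastMsg z))} ≤ A.numMsgs := by
  have lastMsg_pos : 0 < A.lastMsg := Nat.succ_pos _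
  set a : ℕ → F := fun j => ∑ u, A.eqnTerm c claim u (adjRow G u) (D c u) j
  have sum_eqnTerm_eq (z : F) {j : ℕ} (hj : j < A.numMsgs) :
      ∑ u, A.eqnTerm (update c A.lastMsg z) claim u (adjRow G u) (D (update c A.lastMsg z) u) j =
        a j :=
    sum_congr rfl fun u _ => eqnTerm_congr claim u _ (fun t ht => update_of_ne ht.ne _ _)
      (fun t ht => hD.update_eq c ht z u) hj
  set p : ℕ → F := fun i => if i = 0 then ∑ u, (D c u 0).treeValue else a (i - 1) with hp
  have sum_eq_zero : ∀ z, A.BadBatch G (update c A.lastMsg z) claim (D (update c A.lastMsg z)) →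
      (∃ j < A.numMsgs, a j ≠ 0) ∧ ∑ i ∈ range (A.numMsgs + 1), p i * z ^ i = 0 := by
    rintro z ⟨hne, hsum⟩
    rw [equationsHold_iff] at hne
    push Not at hne
    obtain ⟨j, hj, hne⟩ := hne
    rw [sum_eqnTerm_eq z hj] at hne
    refine ⟨⟨j, hj, hne⟩, ?_⟩
    rw [sum_localSum, update_self, add_comm] at hsum
    rw [sum_range_succ', ← hsum]
    simp only [hp, if_true, pow_zero, mul_one, Nat.succ_ne_zero, if_false, Nat.add_sub_cancel,
      hD.update_eq c lastMsg_pos]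
    congr 1
    exact sum_congr rfl fun i hi => by rw [sum_eqnTerm_eq z (mem_range.1 hi)]
  by_cases hviolated : ∃ j < A.numMsgs, a j ≠ 0
  · obtain ⟨j, hj, hne⟩ := hviolated
    exact (card_le_card fun z hz => mem_filter.2
      ⟨mem_univ z, (sum_eq_zero z (mem_filter.1 hz).2).2⟩).trans
        (card_sum_mul_pow_eq_zero_le (j := j + 1) (Nat.succ_lt_succ hj) (by simpa [hp] using hne))
  · rw [filter_false_of_mem fun z _ hz => hviolated (sum_eq_zero z hz).1, card_empty]
    exact Nat.zero_le _

end CountingScheme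

end CausalProver

section UniformDistribution

lemma uniform_apply_le_of_perm {Ω X : Type*} [Fintype Ω] [Nonempty Ω] [Fintype X] [Nonempty X]
    (σ : X → Equiv.Perm Ω) {B : Set Ω} [DecidablePred (· ∈ B)] {d : ℕ}
    (h : ∀ ω, #{x | σ x ω ∈ B} ≤ d) :
    (PMF.uniformOfFintype Ω).toOuterMeasure B ≤ d / Fintype.card X := by
  have card_image (x : X) : #{ω | σ x ω ∈ B} = #{ω | ω ∈ B} :=
    card_equiv (σ x) (by simp)
  have double_count : #{ω | ω ∈ B} * Fintype.card X ≤ d * Fintype.card Ω :=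
    calc #{ω | ω ∈ B} * Fintype.card X = ∑ x : X, #{ω | σ x ω ∈ B} := by
          simp only [card_image, sum_const, card_univ, smul_eq_mul, mul_comm]
      _ = ∑ ω, #{x | σ x ω ∈ B} := by simp only [card_filter]; exact sum_comm
      _ ≤ ∑ _ω : Ω, d := sum_le_sum fun ω _ => h ω
      _ = d * Fintype.card Ω := by simp only [sum_const, card_univ, smul_eq_mul, mul_comm]
  rw [PMF.toOuterMeasure_uniformOfFintype_apply, Fintype.card_subtype]
  refine ENNReal.div_le_of_le_mul ?_
  rw [← ENNReal.mul_div_right_comm, ENNReal.le_div_iff_mul_le (.inl (by simp)) (.inl (by simp))]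
  exact_mod_cast double_count

end UniformDistribution

section SoundnessBound

variable {F : Type} [Field F] {n R : ℕ} [NeZero n]

/-- The permutation of the randomness that adds `x` to coin `τ` of the root. -/
def shiftCoin {S : Type} (τ : Fin R) (x : F) : Equiv.Perm (S × (Fin n → Fin R → F)) :=
  (Equiv.refl S).prodCongr (Equiv.addRight (Pi.single 0 (Pi.single τ x)))

lemma padZero_shiftCoin {S : Type} (τ : Fin R) (x : F) (ω : S × (Fin n → Fin R → F)) :
    padZero ((shiftCoin τ x ω).2 0) =
      update (padZero (ω.2 0)) τ (padZero (ω.2 0) τ + x) := by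
  funext i
  have shift : (shiftCoin τ x ω).2 0 = ω.2 0 + Pi.single τ x := by simp [shiftCoin]
  rw [shift]
  rcases eq_or_ne i τ with rfl | hi
  · simp [padZero]
  · rw [update_of_ne hi]
    unfold padZero
    split_ifs with hlt
    · simp [Fin.ext_iff, hi]
    · rfl

variable [Fintype F]

open Classical in
lemma uniform_apply_le_of_update {S : Type} [Fintype S] [Nonempty S] {τ d : ℕ} (hτ : τ < R)
    {B : S → (ℕ → F) → Prop} (h : ∀ s c, #{z | B s (update c τ z)} ≤ d) :
    (PMF.uniformOfFintype (S × (Fin n → Fin R → F))).toOuterMeasure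
      {ω | B ω.1 (padZero (ω.2 0))} ≤ d / Fintype.card F := by
  refine uniform_apply_le_of_perm (shiftCoin ⟨τ, hτ⟩) fun ω => ?_
  refine le_trans ?_ (h ω.1 (padZero (ω.2 0)))
  refine card_le_card_of_injOn (padZero (ω.2 0) τ + ·) (fun x hx => ?_)
    (add_right_injective _).injOn
  have hx := (mem_filter.1 hx).2
  rw [Set.mem_ofPred_eq, padZero_shiftCoin] at hx
  exact mem_filter.2 ⟨mem_univ _, hx⟩

variable {ℓ b : ℕ}

namespace CountingScheme

lemma allAccept_subset (A : CountingScheme n)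
    (hcast : Set.InjOn (Nat.cast : ℕ → F) (Set.Iic A.bound)) (C : Codec (ProverMsg F) ℓ)
    (C' : Codec (NodeMsg F) b) (P : Prover n ℓ) {N : Network n ℕ}
    (hN : N ∉ A.language) :
    {ω | AllAccept (A.verifier C C') P N (2 * A.numMsgs) 1 ω} ⊆
      ((⋃ t ∈ range (A.numVars + 1), {ω | A.BadRound N.graph (padZero (ω.2 0))
        (A.messagesOf C P ω.1 (padZero (ω.2 0))) t}) ∪
      ⋃ u ∈ (univ : Finset (Fin n)), {ω | A.BadFingerprint (padZero (ω.2 0))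
        (A.messagesOf C P ω.1 (padZero (ω.2 0)) u)}) ∪
      {ω | A.BadBatch N.graph (padZero (ω.2 0)) (A.claimOf F (N.label 0))
        (A.messagesOf C P ω.1 (padZero (ω.2 0)))} := by
  intro ω hω
  by_contra hbad
  simp only [Set.mem_union, Set.mem_iUnion, Set.mem_ofPred_eq, mem_range, mem_univ, not_or,
    not_exists, exists_prop, not_and, true_implies, Nat.lt_succ_iff] at hbad
  obtain ⟨⟨hround, hfingerprint⟩, hbatch⟩ := hbad
  have accepts := (A.allAccept_iff C P C' N ω).1 hω
  exact hN ⟨_, fun v => accepts.label_eq hcast v 0,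
    accepts.label_mul_aut_eq hcast hround hfingerprint hbatch⟩

lemma acceptProb_le_sum (A : CountingScheme n)
    (hcast : Set.InjOn (Nat.cast : ℕ → F) (Set.Iic A.bound)) (C : Codec (ProverMsg F) ℓ)
    (C' : Codec (NodeMsg F) b) (P : Prover n ℓ) {N : Network n ℕ} (hN : N ∉ A.language) :
    acceptProb (A.verifier C C') P N (2 * A.numMsgs) 1 ≤
      ((∑ _t ∈ range (A.numVars + 1), (n / Fintype.card F : ENNReal)) +
        ∑ _u : Fin n, (A.numMsgs / Fintype.card F : ENNReal)) +
        (A.numMsgs / Fintype.card F : ENNReal) := by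
  have causal (s : P.Seed) := A.isCausal_messagesOf C P s
  have numMsgs_eq : A.numMsgs = A.numVars + A.κ + 2 := rfl
  have measure_badRound : ∀ t ∈ range (A.numVars + 1), _ ≤ (n / Fintype.card F : ENNReal) :=
    fun t ht => uniform_apply_le_of_update (n := n) (S := P.Seed)
      (B := fun s c => A.BadRound N.graph c (A.messagesOf C P s c) t)
      (show t + 1 < A.numMsgs by have := mem_range.1 ht; omega)
      fun s c => card_badRound_le (causal s) N.graph c (Nat.lt_succ_iff.1 (mem_range.1 ht))
  have measure_badFingerprint : ∀ u ∈ (univ : Finset (Fin n)), _ ≤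
      (A.numMsgs / Fintype.card F : ENNReal) :=
    fun u _ => uniform_apply_le_of_update (n := n) (S := P.Seed)
      (B := fun s c => A.BadFingerprint c (A.messagesOf C P s c u)) A.lastMsg_lt
      fun s c => card_badFingerprint_le (causal s) c u
  have measure_badBatch := uniform_apply_le_of_update (n := n) (S := P.Seed)
    (B := fun s c => A.BadBatch N.graph c (A.claimOf F (N.label 0)) (A.messagesOf C P s c))
    A.lastMsg_lt fun s c => card_badBatch_le (causal s) N.graph _ c
  refine (MeasureTheory.measure_mono (A.allAccept_subset hcast C C' P hN)).trans ?_
  refine (MeasureTheory.measure_union_le _ _).trans (add_le_add ?_ measure_badBatch)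
  refine (MeasureTheory.measure_union_le _ _).trans (add_le_add ?_ ?_)
  · exact (MeasureTheory.measure_biUnion_finset_le _ _).trans (sum_le_sum measure_badRound)
  · exact (MeasureTheory.measure_biUnion_finset_le _ _).trans (sum_le_sum measure_badFingerprint)

lemma acceptProb_le (A : CountingScheme n)
    (hcast : Set.InjOn (Nat.cast : ℕ → F) (Set.Iic A.bound))
    (hF : 3 * ((A.numVars + 1) * n + n * A.numMsgs + A.numMsgs) ≤ Fintype.card F)
    (C : Codec (ProverMsg F) ℓ) (C' : Codec (NodeMsg F) b) (P : Prover n ℓ) {N : Network n ℕ}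
    (hN : N ∉ A.language) :
    acceptProb (A.verifier C C') P N (2 * A.numMsgs) 1 ≤ 1 / 3 :=
  calc acceptProb (A.verifier C C') P N (2 * A.numMsgs) 1
      ≤ _ := A.acceptProb_le_sum hcast C C' P hN
    _ = (((A.numVars + 1) * n + n * A.numMsgs + A.numMsgs : ℕ) : ENNReal) / Fintype.card F := by
        simp only [sum_const, card_range, card_univ, Fintype.card_fin, nsmul_eq_mul]
        push_cast
        simp only [ENNReal.add_div, mul_div_assoc]
    _ ≤ 1 / 3 := by
        refine ENNReal.div_le_of_le_mul ?_
        rw [← ENNReal.mul_div_right_comm, one_mul,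
          ENNReal.le_div_iff_mul_le (.inl (by norm_num)) (.inl (by norm_num)), mul_comm]
        exact_mod_cast hF

end CountingScheme

end SoundnessBound

/-! ### The honest prover -/

section SubtreeSum

variable {F : Type} [Field F] {n : ℕ} [NeZero n] {Λ : Type} (N : Network n Λ)

open Classical in
/-- The incidence matrix of nodes and their children. -/
def Network.childMatrix (F : Type) [Field F] : Matrix (Fin n) (Fin n) F :=
  Matrix.of fun v u => if u ∈ N.children v then 1 else 0

lemma Network.childMatrix_mulVec (f : Fin n → F) (v : Fin n) :
    (N.childMatrix F).mulVec f v = ∑ u ∈ N.children v, f u := by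
  simp [childMatrix, Matrix.mulVec, dotProduct]

lemma Network.transpose_childMatrix_mulVec (f : Fin n → F) (u : Fin n) :
    (N.childMatrix F).transpose.mulVec f u = if u = 0 then 0 else f (N.parent u) := by
  by_cases hu : u = 0 <;>
    simp [childMatrix, children, Matrix.mulVec, dotProduct, hu]

lemma Network.isUnit_one_sub_childMatrix : IsUnit (1 - N.childMatrix F) := by
  rw [← Matrix.isUnit_transpose, ← Matrix.mulVec_injective_iff_isUnit, ← Matrix.coe_mulVecLin,
    ← LinearMap.ker_eq_bot, LinearMap.ker_eq_bot']
  intro f hf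
  have eq_parent : ∀ u, f u = if u = 0 then 0 else f (N.parent u) := fun u => by
    have hu := congrFun hf u
    rwa [Matrix.mulVecLin_apply, Matrix.transpose_sub, Matrix.sub_mulVec, Matrix.transpose_one,
      Matrix.one_mulVec, Pi.sub_apply, transpose_childMatrix_mulVec, Pi.zero_apply,
      sub_eq_zero] at hu
  have eq_zero : ∀ d u, N.parent^[d] u = 0 → f u = 0 := by
    intro d
    induction d with
    | zero =>
      rintro u rfl
      exact (eq_parent _).trans (if_pos rfl)
    | succ d ih =>
      intro u hu
      rw [eq_parent, ih _ hu, ite_self]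
  funext u
  obtain ⟨d, hd⟩ := N.reaches_root u
  exact eq_zero d u (Fin.val_eq_zero_iff.1 hd)

lemma Network.exists_subtreeSum (f : Fin n → F) :
    ∃ S : Fin n → F, ∀ v, S v = f v + ∑ u ∈ N.children v, S u := by
  obtain ⟨S, hS⟩ := Matrix.mulVec_surjective_iff_isUnit.2 N.isUnit_one_sub_childMatrix f
  refine ⟨S, fun v => ?_⟩
  have hv := congrFun hS v
  rwa [Matrix.sub_mulVec, Matrix.one_mulVec, Pi.sub_apply, childMatrix_mulVec,
    sub_eq_iff_eq_add] at hv

/-- The sums of a function over the subtrees of the spanning tree. -/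
def Network.subtreeSum (f : Fin n → F) : Fin n → F := (N.exists_subtreeSum f).choose

lemma Network.subtreeSum_eq (f : Fin n → F) (v : Fin n) :
    N.subtreeSum f v = f v + ∑ u ∈ N.children v, N.subtreeSum f u :=
  (N.exists_subtreeSum f).choose_spec v

lemma Network.subtreeSum_root (f : Fin n → F) : N.subtreeSum f 0 = ∑ v, f v := by
  have total := sum_congr (s₁ := univ) rfl fun v _ => N.subtreeSum_eq f v
  rw [sum_add_distrib, N.sum_children] at total
  linear_combination total

end SubtreeSum

/-- Coefficients of a polynomial function of degree less than `n`. -/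
def HasDegreeLE.coeff {R : Type*} [CommRing R] {d n : ℕ} {g : R → R} (hg : HasDegreeLE d g)
    (hdn : d < n) : Fin n → R := (hg.exists_coeff hdn).choose

lemma HasDegreeLE.sum_coeff_mul_pow {R : Type*} [CommRing R] {d n : ℕ} {g : R → R}
    (hg : HasDegreeLE d g) (hdn : d < n) (z : R) : ∑ j, hg.coeff hdn j * z ^ (j : ℕ) = g z :=
  ((hg.exists_coeff hdn).choose_spec z).symm

/-- The randomness of the honest prover: the shares `coeff'` of the coefficients of the round
polynomials (`coeffShare t j` belongs to coefficient `j`), the shares of the masks of the factors,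
and the masks of the sums over the subtrees. -/
structure HonestSeed (F : Type) (n R : ℕ) where
  coeffShare : Fin R → Fin n → F
  maskShare : Fin R → Fin n → F
  treeMask : Fin n → F

namespace HonestSeed

variable {F : Type} {n R : ℕ}

instance [Fintype F] : Fintype (HonestSeed F n R) := by
  classical
  refine Fintype.ofInjective (fun σ => (σ.coeffShare, σ.maskShare, σ.treeMask)) ?_
  rintro ⟨s, M, m⟩ ⟨s', M', m'⟩ h
  simp only [Prod.mk.injEq] at h
  obtain ⟨rfl, rfl, rfl⟩ := h
  rfl

instance [Nonempty F] : Nonempty (HonestSeed F n R) := by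
  inhabit F
  exact ⟨⟨fun _ _ => default, fun _ _ => default, fun _ => default⟩⟩

/-- The masks of the sums over the subtrees. The total sum at the root is not masked. -/
def nodeMask [Zero F] [NeZero n] (σ : HonestSeed F n R) : Fin n → F := update σ.treeMask 0 0

/-- The masks of the factors. -/
def factorMask [AddCommMonoid F] (σ : HonestSeed F n R) (i : ℕ) : F :=
  ∑ u, padZero σ.maskShare i u

end HonestSeed

section HonestProver

variable {F : Type} [Field F] {n ℓ b : ℕ}

namespace CountingScheme

variable (A : CountingScheme n)

/-- The messages to a node with given entries `coin`, `coeff`, `coeff'`, `maskShare` and masked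
factors. -/
def assemble (c a a' μ y : ℕ → F) : Messages F := fun t =>
  if t < A.numMsgs then
    { coin := c t
      coeff := a t
      coeff' := a' t
      maskShare := μ t
      maskedFactor := if A.numVars < t ∧ t < A.lastMsg then y (t - (A.numVars + 1)) else 0
      treeValue := 0 }
  else 0

/-- The messages `D` with the entries `treeValue` of the first and the last one replaced. -/
def withTree (first last : F) (D : Messages F) : Messages F := fun t =>
  { D t with treeValue := if t = 0 then first else if t = A.lastMsg then last else 0 }

lemma withTree_zero (first last : F) (D : Messages F) :
    (A.withTree first last D 0).treeValue = first := by
  rw [withTree, if_pos rfl]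

lemma withTree_lastMsg (first last : F) (D : Messages F) :
    (A.withTree first last D A.lastMsg).treeValue = last := by
  have lastMsg_ne_zero : A.lastMsg ≠ 0 := Nat.succ_ne_zero _
  simp only [withTree, lastMsg_ne_zero, if_false, if_true]

lemma maskedFactor_assemble (c a a' μ y : ℕ → F) {i : ℕ} (hi : i < A.κ) :
    A.maskedFactor (A.assemble c a a' μ y) i = y i := by
  have lastMsg_eq : A.lastMsg = A.numVars + A.κ + 1 := rfl
  have numMsgs_eq : A.numMsgs = A.lastMsg + 1 := rfl
  rw [maskedFactor, assemble, if_pos (by omega), if_pos (by omega), Nat.add_sub_cancel_left]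

variable (N : Network n ℕ) (σ : HonestSeed F n A.numMsgs) (c : ℕ → F)

/-- The coefficients of the polynomial of round `t`. -/
def honestCoeff (t : ℕ) : Fin n → F :=
  (A.hasDegreeLE_roundFun N.graph (sumcheckPoint c) σ.factorMask t).coeff A.κ_lt

/-- The masked factors. -/
def honestFactor (i : ℕ) : F :=
  A.factor N.graph (i + 1) (sumcheckPoint c) + A.maskPoint c * σ.factorMask i

/-- The messages of the honest prover to node `v`, without the entries `treeValue`. -/
def honestBase (v : Fin n) : Messages F :=
  A.assemble c (fun t => A.honestCoeff N σ c t v - padZero σ.coeffShare t v)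
    (fun t => padZero σ.coeffShare t (finRotate n v)) (fun t => padZero σ.maskShare t v)
    (A.honestFactor N σ c)

lemma sharedMask_honestBase {i : ℕ} (hi : i < A.numMsgs) :
    sharedMask (A.honestBase N σ c) i = σ.factorMask i := by
  simp only [sharedMask, honestBase, assemble, hi, if_true, HonestSeed.factorMask]

lemma sharedFun_honestBase {t : ℕ} (ht : t ≤ A.numVars) :
    sharedFun (A.honestBase N σ c) t =
      A.roundFun N.graph (sharedMask (A.honestBase N σ c)) t (sumcheckPoint c) := by
  have lastMsg_eq : A.lastMsg = A.numVars + A.κ + 1 := rfl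
  have numMsgs_eq : A.numMsgs = A.lastMsg + 1 := rfl
  have ht' : t < A.numMsgs := by omega
  funext z
  rw [A.roundFun_congr N.graph (fun _ _ => rfl) fun _ i hi =>
    A.sharedMask_honestBase N σ c (by omega), sharedFun_eq]
  simp only [honestBase, assemble, ht', if_true, Equiv.apply_symm_apply, sub_add_cancel]
  exact HasDegreeLE.sum_coeff_mul_pow _ _ z

variable {c} in
lemma honestBase_congr {c' : ℕ → F} {t : ℕ} (h : ∀ i ≤ t, c i = c' i) (v : Fin n)
    (ht : t < A.lastMsg) : A.honestBase N σ c v t = A.honestBase N σ c' v t := by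
  have lastMsg_eq : A.lastMsg = A.numVars + A.κ + 1 := rfl
  have roundFun_eq : A.roundFun N.graph σ.factorMask t (sumcheckPoint c) =
      A.roundFun N.graph σ.factorMask t (sumcheckPoint c') :=
    funext <| A.roundFun_congr N.graph (fun i hi => h (i + 1) hi) fun _ _ _ => rfl
  have factor_eq (ht : A.numVars < t ∧ t < A.lastMsg) :
      A.honestFactor N σ c (t - (A.numVars + 1)) =
        A.honestFactor N σ c' (t - (A.numVars + 1)) := by
    have factor_eq := A.factor_congr (i := t - (A.numVars + 1) + 1) N.graph (by omega)
      (x := sumcheckPoint c) (y := sumcheckPoint c') fun i hi =>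
        h (i + 1) (by have := mem_range.1 hi; omega)
    rw [honestFactor, honestFactor, maskPoint, maskPoint, h _ (by omega), factor_eq]
  simp only [honestBase, assemble, honestCoeff, roundFun_eq, h t le_rfl]
  congr 2
  exact if_ctx_congr Iff.rfl factor_eq fun _ => rfl

variable [NeZero n]

/-- The sums over the subtrees of the contributions of the nodes to the batch of all equations. -/
def honestSum : Fin n → F :=
  N.subtreeSum fun v => A.localSum c (A.claimOf F (N.label v)) v (adjRow N.graph v)
    (A.honestBase N σ c v)

lemma localSum_withTree (claim : F) (v : Fin n) (row : Fin n → Bool) (first last : F)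
    (D : Messages F) :
    A.localSum c claim v row (A.withTree first last D) = A.localSum c claim v row D :=
  rfl

/-- The messages of the honest prover. -/
def honestMsgs (v : Fin n) : Messages F :=
  A.withTree (σ.nodeMask v - ∑ u ∈ N.children v, σ.nodeMask u)
    (σ.nodeMask v + A.honestSum N σ c v) (A.honestBase N σ c v)

lemma coin_honestMsgs (v : Fin n) {t : ℕ} (ht : t < A.numMsgs) :
    (A.honestMsgs N σ c v t).coin = c t := by
  simp only [honestMsgs, withTree, honestBase, assemble, ht, if_true]

lemma honestMsgs_of_le (v : Fin n) {t : ℕ} (ht : A.numMsgs ≤ t) : A.honestMsgs N σ c v t = 0 := by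
  have numMsgs_eq : A.numMsgs = A.lastMsg + 1 := rfl
  simp only [honestMsgs, withTree, honestBase, assemble, not_lt.2 ht, if_false,
    show t ≠ 0 by omega, show t ≠ A.lastMsg by omega]
  rfl

variable {c} in
lemma honestMsgs_congr {c' : ℕ → F} {t : ℕ} (h : ∀ i ≤ t, c i = c' i) (v : Fin n)
    (ht : t < A.lastMsg) : A.honestMsgs N σ c v t = A.honestMsgs N σ c' v t := by
  simp only [honestMsgs, withTree, A.honestBase_congr N σ h v ht, ht.ne, if_false]

lemma fingerprint_honestMsgs (v : Fin n) (z : F) :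
    A.fingerprint (coinsOf (A.honestMsgs N σ c v)) z = A.fingerprint c z :=
  sum_congr rfl fun t ht => by
    rw [coinsOf, coin_honestMsgs _ _ _ _ _ ((mem_range.1 ht).trans A.lastMsg_lt)]

variable {N} in
lemma honestSum_root (hN : N ∈ A.language) : A.honestSum N σ c 0 = 0 := by
  obtain ⟨Δ, label_eq, count_eq⟩ := hN
  have lastMsg_eq : A.lastMsg = A.numVars + A.κ + 1 := rfl
  have numMsgs_eq : A.numMsgs = A.lastMsg + 1 := rfl
  have equations : A.EquationsHold N.graph c (A.claimOf F Δ) (A.honestBase N σ c) := by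
    refine .of_sharedFun_eq (by rw [claimOf, count_eq])
      (fun t ht => A.sharedFun_honestBase N σ c ht) fun i hi => ?_
    rw [A.sharedMask_honestBase N σ c (by omega)]
    exact A.maskedFactor_assemble _ _ _ _ _ hi
  simp only [honestSum, Network.subtreeSum_root, label_eq, sum_localSum]
  exact sum_eq_zero fun j hj => by
    rw [equationsHold_iff.1 equations j (mem_range.1 hj), zero_mul]

lemma honestSum_eq (v : Fin n) : A.honestSum N σ c v =
    A.localSum c (A.claimOf F (N.label v)) v (adjRow N.graph v) (A.honestBase N σ c v) +
      ∑ u ∈ N.children v, A.honestSum N σ c u :=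
  N.subtreeSum_eq _ v

variable {N} in
lemma accepts_honestMsgs (hN : N ∈ A.language) : A.Accepts N c (A.honestMsgs N σ c) := by
  obtain ⟨Δ, label_eq, count_eq⟩ := id hN
  have lastCoin_eq (v : Fin n) : (A.honestMsgs N σ c v A.lastMsg).coin = c A.lastMsg :=
    A.coin_honestMsgs N σ c v A.lastMsg_lt
  refine ⟨fun v => ?_, fun t => A.coin_honestMsgs N σ c 0, ?_, fun u v _ => ?_, fun u v _ => ?_,
    fun u v _ => ?_, fun v => ?_⟩
  · rw [label_eq, count_eq]
    exact A.tupleCount_le_bound _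
  · rw [honestMsgs, withTree_lastMsg, A.honestSum_root σ c hN, HonestSeed.nodeMask, update_self,
      add_zero]
  · rw [lastCoin_eq, lastCoin_eq]
  · rw [lastCoin_eq, lastCoin_eq, fingerprint_honestMsgs, fingerprint_honestMsgs]
  · rw [label_eq, label_eq]
  · have localSum_eq := localSum_congr (A := A)
      (c := coinsOf (A.honestMsgs N σ c v)) (fun t => A.coin_honestMsgs N σ c v)
      (A.claimOf F (N.label v)) v (adjRow N.graph v) (A.honestMsgs N σ c v)
    have honestSum_eq := A.honestSum_eq N σ c v
    rw [localSum_eq]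
    simp only [honestMsgs, withTree_lastMsg, withTree_zero, sum_add_distrib]
    rw [honestSum_eq, localSum_withTree]
    ring

variable (C : Codec (ProverMsg F) ℓ)

/-- The honest prover. -/
def honestProver [Fintype F] : Prover n ℓ where
  Seed := HonestSeed F n A.numMsgs
  strategy σ L v := C.enc (A.honestMsgs N σ (fun t => (decodeList C (L.map (· 0)) t).coin) v
    (L.length - 1))

lemma strategy_honestProver [Fintype F] (coin : Fin A.numMsgs → F) (v : Fin n) {t : ℕ}
    (ht : t < A.numMsgs) :
    (A.honestProver N C).strategy σ ((List.range (t + 1)).map (respAt C (padZero coin))) v =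
      C.enc (A.honestMsgs N σ (padZero coin) v t) := by
  have numMsgs_eq : A.numMsgs = A.lastMsg + 1 := rfl
  have decode_eq : (fun i => (decodeList C
      (((List.range (t + 1)).map (respAt (n := n) C (padZero coin))).map (· 0)) i).coin) =
        fun i => if i < t + 1 then padZero coin i else 0 := by
    funext i
    by_cases hi : i < t + 1
    · simp [decodeList, respAt, C.dec_enc, List.getD, hi]
    · simp only [decodeList, List.getD, hi, if_false, List.getElem?_map]
      simp [hi]
      rfl
  simp only [honestProver, decode_eq, List.length_map, List.length_range, Nat.add_sub_cancel]
  congr 1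
  rcases (Nat.le_of_lt_succ ht).lt_or_eq with ht | rfl
  · exact A.honestMsgs_congr N σ (fun i hi => if_pos (Nat.lt_succ_of_le hi)) v ht
  · congr 1
    funext i
    exact ite_eq_left_iff.2 fun hi => by rw [padZero, dif_neg (numMsgs_eq ▸ hi)]

lemma messagesOf_honestProver [Fintype F] (coin : Fin A.numMsgs → F) :
    A.messagesOf C (A.honestProver N C) σ (padZero coin) = A.honestMsgs N σ (padZero coin) := by
  funext v t
  unfold messagesOf
  split_ifs with ht
  · rw [strategy_honestProver A N σ C coin v ht, C.dec_enc]
  · exact (A.honestMsgs_of_le N σ _ v (not_lt.1 ht)).symm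

variable {N} in
lemma allAccept_honestProver [Fintype F] (C' : Codec (NodeMsg F) b) (hN : N ∈ A.language)
    (ω : Randomness (A.verifier C C') (A.honestProver N C)) :
    AllAccept (A.verifier C C') (A.honestProver N C) N (2 * A.numMsgs) 1 ω := by
  refine (A.allAccept_iff C _ C' N ω).2 ?_
  exact (A.messagesOf_honestProver N ω.1 C (ω.2 0)).symm ▸ A.accepts_honestMsgs ω.1 _ hN

end CountingScheme

end HonestProver

/-! ### Zero knowledge -/

section Uniform

open Classical in
lemma map_uniform_of_card_fiber {α β : Type*} [Fintype α] [Nonempty α] [Fintype β] [Nonempty β]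
    {f : α → β} {m : ℕ} (hf : ∀ y, #{a | f a = y} = m) :
    (PMF.uniformOfFintype α).map f = PMF.uniformOfFintype β := by
  refine PMF.ext fun y => ?_
  have card_eq : Fintype.card α = Fintype.card β * m := by
    rw [← card_univ (α := α), card_eq_sum_card_fiberwise fun a _ => mem_univ (f a),
      sum_const_nat fun y _ => hf y, card_univ]
  have card_ne_zero : (Fintype.card α : ENNReal) ≠ 0 := by exact_mod_cast Fintype.card_ne_zero
  simp only [PMF.map_apply, tsum_fintype, PMF.uniformOfFintype_apply]
  rw [← sum_filter, sum_const, nsmul_eq_mul, filter_congr fun a _ => eq_comm, hf y]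
  refine ENNReal.eq_inv_of_mul_eq_one_left ?_
  rw [mul_right_comm, mul_comm (m : ENNReal), ← Nat.cast_mul, ← card_eq]
  exact ENNReal.mul_inv_cancel card_ne_zero (ENNReal.natCast_ne_top _)

lemma map_uniform_of_bijective {α β : Type*} [Fintype α] [Nonempty α] [Fintype β] [Nonempty β]
    {f : α → β} (hf : Bijective f) :
    (PMF.uniformOfFintype α).map f = PMF.uniformOfFintype β := by
  classical
  refine map_uniform_of_card_fiber (m := 1) fun y => card_eq_one.2 ?_
  obtain ⟨a, rfl, unique⟩ := hf.existsUnique y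
  exact ⟨a, by simpa [Finset.ext_iff] using fun b => ⟨unique b, congrArg f⟩⟩

lemma map_uniform_eval {ι X : Type*} [Fintype ι] [DecidableEq ι] [Fintype X] [Nonempty X] (v : ι) :
    (PMF.uniformOfFintype (ι → X)).map (fun f => f v) = PMF.uniformOfFintype X := by
  classical
  refine map_uniform_of_card_fiber (m := Fintype.card X ^ (Fintype.card ι - 1)) fun x => ?_
  rw [← card_univ (α := X), ← Fintype.card_filter_piFinset_const_eq_of_mem univ v (mem_univ x),
    Fintype.piFinset_univ]

end Uniform

lemma finRotate_ne_self {n : ℕ} (hn : 2 ≤ n) (v : Fin n) : finRotate n v ≠ v := by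
  have : NeZero n := ⟨by omega⟩
  simpa only [finRotate_apply, Ne, add_eq_left, Fin.one_eq_zero_iff] using (by omega : n ≠ 1)

lemma eq_of_sum_eq {ι M : Type*} [Fintype ι] [AddCancelCommMonoid M] {f g : ι → M} (i : ι)
    (hne : ∀ j ≠ i, f j = g j) (hsum : ∑ j, f j = ∑ j, g j) : f = g := by
  classical
  funext j
  rcases eq_or_ne j i with rfl | hj
  · rw [← add_sum_erase _ _ (mem_univ j), ← add_sum_erase _ _ (mem_univ j),
      sum_congr rfl fun k hk => hne k (ne_of_mem_erase hk)] at hsum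
    exact add_right_cancel hsum
  · exact hne j hj

section Simulator

variable {F : Type} [Field F] {n ℓ b : ℕ} [NeZero n]

/-- The randomness of a node in the simulation: the node draws for itself the randomness of the
honest prover and of all nodes. -/
abbrev SimCoin (F : Type) (n R : ℕ) : Type := HonestSeed F n R × (Fin n → Fin R → F)

namespace CountingScheme

variable (A : CountingScheme n)

/-- The simulated messages to node `v`, without the entries `treeValue`. The entries which node `v`
would see through a difference or a sum with an unseen share are drawn uniformly. -/
def simBase (o : SimCoin F n A.numMsgs) (v : Fin n) : Messages F :=
  A.assemble (padZero (o.2 0)) (fun t => padZero o.1.coeffShare t v)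
    (fun t => padZero o.1.coeffShare t (finRotate n v)) (fun t => padZero o.1.maskShare t v)
    fun i => padZero o.1.maskShare i (finRotate n v)

/-- The simulated messages to a node with the given children and adjacency row. The last entry
`treeValue` is drawn uniformly, and the first one is computed from the equation that the node
checks. -/
def simMsgs (inp : LocalInput n ℕ) (row : Fin n → Bool) (children : Finset (Fin n))
    (o : SimCoin F n A.numMsgs) : Messages F :=
  A.withTree (o.1.nodeMask inp.id - A.localSum (padZero (o.2 0)) (A.claimOf F inp.label) inp.id row
    (A.simBase o inp.id) - ∑ u ∈ children, o.1.nodeMask u) (o.1.nodeMask inp.id)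
    (A.simBase o inp.id)

/-- The simulated message from a neighbour. -/
def simNodeMsg (inp : LocalInput n ℕ) (children : Finset (Fin n)) (o : SimCoin F n A.numMsgs)
    (u : Fin n) : NodeMsg F where
  subtreeSum := if u ∈ children then o.1.nodeMask u else 0
  lastCoin := padZero (o.2 0) A.lastMsg
  fingerprint := A.fingerprint (padZero (o.2 0)) (padZero (o.2 0) A.lastMsg)
  claim := A.claimOf F inp.label

variable (C : Codec (ProverMsg F) ℓ) (C' : Codec (NodeMsg F) b)

/-- The simulated view. -/
def simView (inp : LocalInput n ℕ) (row : Fin n → Bool) (children : Finset (Fin n))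
    (o : SimCoin F n A.numMsgs) : View n ℓ b (Fin A.numMsgs → F) where
  coin := o.2 inp.id
  fromProver := (List.range A.numMsgs).map fun t => C.enc (A.simMsgs inp row children o t)
  fromNeighbors :=
    [fun u => if row u then some (C'.enc (A.simNodeMsg inp children o u)) else none]

open Classical in
/-- The simulator. The only communication is that the nodes tell their parents that they are their
children. -/
def simulator [Fintype F] : Simulator n b ℕ (View n ℓ b (A.verifier C C').Coin) where
  Coin := SimCoin F n A.numMsgs
  alg :=
    { send := fun d _ v => C'.enc ⟨if v = d.1.parent then 1 else 0, 0, 0, 0⟩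
      out := fun d L => A.simView C C' d.1 (fun u => (L.headD (fun _ => none) u).isSome)
        {u | ∃ x ∈ L.headD (fun _ => none) u, (C'.dec x).subtreeSum = 1} d.2 }

variable (N : Network n ℕ)

lemma run_simulator [Fintype F] (coins : Fin n → SimCoin F n A.numMsgs) (v : Fin n) :
    (A.simulator C C').alg.run 1 N.graph (fun u => (N.input u, coins u)) v =
      A.simView C C' (N.input v) (adjRow N.graph v) (N.children v) (coins v) := by
  classical
  simp only [LocalAlg.run, LocalAlg.received, List.nil_append, simulator, Network.input,
    List.headD_cons]
  congr 1
  · funext u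
    by_cases h : N.graph.Adj u v
    · simp [adjRow, h, h.symm]
    · simp [adjRow, h, N.graph.adj_comm v u]
  · ext u
    by_cases h : N.graph.Adj u v <;> simp [Network.mem_children_iff, C'.dec_enc, h]

/-- The randomness of the simulator at node `v` that produces the view of `v` in the interaction
with the honest prover. -/
def reveal (v : Fin n) (o : SimCoin F n A.numMsgs) : SimCoin F n A.numMsgs :=
  ({ coeffShare := fun t u =>
      if u = v then A.honestCoeff N o.1 (padZero (o.2 0)) t v - o.1.coeffShare t v
      else o.1.coeffShare t u
     maskShare := fun i u =>
      if u = finRotate n v ∧ (i : ℕ) < A.κ then A.honestFactor N o.1 (padZero (o.2 0)) i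
      else o.1.maskShare i u
     treeMask := fun u => o.1.treeMask u + A.honestSum N o.1 (padZero (o.2 0)) u }, o.2)

lemma reveal_injective (v : Fin n) :
    Injective (A.reveal N v : SimCoin F n A.numMsgs → SimCoin F n A.numMsgs) := by
  rintro ⟨σ, c⟩ ⟨σ', c'⟩ h
  simp only [reveal, Prod.mk.injEq, HonestSeed.mk.injEq] at h
  obtain ⟨⟨coeffShare_eq, maskShare_eq, treeMask_eq⟩, rfl⟩ := h
  replace coeffShare_eq t u := congrFun (congrFun coeffShare_eq t) u
  replace maskShare_eq i u := congrFun (congrFun maskShare_eq i) u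
  replace treeMask_eq u := congrFun treeMask_eq u
  obtain ⟨s, μ, m⟩ := σ
  obtain ⟨s', μ', m'⟩ := σ'
  have hμ : μ = μ' := by
    funext i
    have eq_of_ne : ∀ u, ¬ (u = finRotate n v ∧ (i : ℕ) < A.κ) → μ i u = μ' i u := fun u hu => by
      simpa only [if_neg hu] using maskShare_eq i u
    by_cases hi : (i : ℕ) < A.κ
    · have factor_eq := maskShare_eq i (finRotate n v)
      simp only [hi, and_true, if_true, honestFactor, add_right_inj] at factor_eq
      have sum_eq := mul_left_cancel₀ (replaceZero_ne_zero _) factor_eq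
      simp only [HonestSeed.factorMask, padZero, i.2, dif_pos] at sum_eq
      refine eq_of_sum_eq (finRotate n v) (fun u hu => eq_of_ne u fun h => hu h.1) sum_eq
    · exact funext fun u => eq_of_ne u fun h => hi h.2
  subst hμ
  have hs : s = s' := by
    funext t u
    by_cases hu : u = v
    · have coeff_eq := coeffShare_eq t u
      rw [if_pos hu, if_pos hu] at coeff_eq
      exact hu ▸ sub_right_injective coeff_eq
    · simpa only [if_neg hu] using coeffShare_eq t u
  subst hs
  have hm : m = m' := funext fun u => add_right_cancel (treeMask_eq u)
  rw [hm]

variable {N} in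
lemma nodeMask_reveal (hN : N ∈ A.language) (v : Fin n) (o : SimCoin F n A.numMsgs) (u : Fin n) :
    (A.reveal N v o).1.nodeMask u =
      o.1.nodeMask u + A.honestSum N o.1 (padZero (o.2 0)) u := by
  rcases eq_or_ne u 0 with rfl | hu
  · rw [A.honestSum_root _ _ hN, HonestSeed.nodeMask, HonestSeed.nodeMask, update_self,
      update_self, add_zero]
  · simp only [HonestSeed.nodeMask, update_of_ne hu, reveal]

lemma simBase_reveal (v : Fin n) (o : SimCoin F n A.numMsgs) :
    A.simBase (A.reveal N v o) v = A.honestBase N o.1 (padZero (o.2 0)) v := by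
  have rotate_ne : finRotate n v ≠ v :=
    finRotate_ne_self (by have := A.κ_pos; have := A.κ_lt; omega) v
  have lastMsg_eq : A.lastMsg = A.numVars + A.κ + 1 := rfl
  have numMsgs_eq : A.numMsgs = A.lastMsg + 1 := rfl
  funext t
  simp only [simBase, honestBase, assemble]
  refine if_ctx_congr Iff.rfl (fun ht => ?_) fun _ => rfl
  congr 1
  · simp only [reveal, padZero, dif_pos ht, if_true]
  · simp only [reveal, padZero, dif_pos ht, rotate_ne, if_false]
  · simp only [reveal, padZero, dif_pos ht, rotate_ne.symm, false_and, if_false]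
  · refine if_ctx_congr Iff.rfl (fun ht' => ?_) fun _ => rfl
    rw [padZero, dif_pos (by omega)]
    exact if_pos ⟨rfl, show t - (A.numVars + 1) < A.κ by omega⟩

variable {N} in
lemma simMsgs_reveal (hN : N ∈ A.language) (v : Fin n) (o : SimCoin F n A.numMsgs) :
    A.simMsgs (N.input v) (adjRow N.graph v) (N.children v) (A.reveal N v o) =
      A.honestMsgs N o.1 (padZero (o.2 0)) v := by
  have honestSum_eq := A.honestSum_eq N o.1 (padZero (o.2 0)) v
  simp only [simMsgs, honestMsgs, Network.input, simBase_reveal, A.nodeMask_reveal hN,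
    sum_add_distrib]
  congr 1
  rw [honestSum_eq]
  simp only [reveal]
  ring

variable {N} in
lemma simNodeMsg_reveal (hN : N ∈ A.language) {u v : Fin n} (huv : N.graph.Adj u v)
    (o : SimCoin F n A.numMsgs) :
    A.simNodeMsg (N.input v) (N.children v) (A.reveal N v o) u =
      A.nodeMsg (N.input u) (A.honestMsgs N o.1 (padZero (o.2 0)) u) v := by
  obtain ⟨Δ, label_eq, -⟩ := id hN
  have children_iff : u ∈ N.children v ↔ v = N.parent u := by
    rw [Network.mem_children_iff, and_iff_right huv]
  have treeValue_eq : (A.honestMsgs N o.1 (padZero (o.2 0)) u A.lastMsg).treeValue =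
      o.1.nodeMask u + A.honestSum N o.1 (padZero (o.2 0)) u := A.withTree_lastMsg _ _ _
  have coins_eq : (A.reveal N v o).2 = o.2 := rfl
  simp only [simNodeMsg, nodeMsg, fingerprint_honestMsgs, A.coin_honestMsgs N _ _ _ A.lastMsg_lt,
    A.nodeMask_reveal hN, Network.input, label_eq, children_iff, treeValue_eq, coins_eq]

variable {N} in
lemma simView_reveal (hN : N ∈ A.language) (v : Fin n) (o : SimCoin F n A.numMsgs) :
    A.simView C C' (N.input v) (adjRow N.graph v) (N.children v) (A.reveal N v o) =
      { coin := o.2 v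
        fromProver := (List.range A.numMsgs).map fun t =>
          C.enc (A.honestMsgs N o.1 (padZero (o.2 0)) v t)
        fromNeighbors :=
          [fun u => (A.inbox N (A.honestMsgs N o.1 (padZero (o.2 0))) v u).map C'.enc] } := by
  simp only [simView, A.simMsgs_reveal hN]
  congr 2
  funext u
  by_cases huv : N.graph.Adj u v
  · simp [adjRow, inbox, huv, huv.symm, A.simNodeMsg_reveal hN huv]
  · simp [adjRow, inbox, huv, N.graph.adj_comm v u]

variable [Fintype F]

variable {N} in
lemma view_eq_simView (hN : N ∈ A.language) (v : Fin n)
    (ω : Randomness (A.verifier C C') (A.honestProver N C)) :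
    (⟨ω.2 v, (interact (A.verifier C C') (A.honestProver N C) N (2 * A.numMsgs) ω
        (2 * A.numMsgs)).toNode v,
      (A.verifier C C').verify.received N.graph
        (verifyInput (A.verifier C C') (A.honestProver N C) N (2 * A.numMsgs) ω) 1 v⟩ :
        View n ℓ b (A.verifier C C').Coin) =
      A.simView C C' (N.input v) (adjRow N.graph v) (N.children v) (A.reveal N v ω) := by
  refine Eq.trans ?_ (A.simView_reveal C C' hN v ω).symm
  rw [received_verifier, toNode_interact]
  congr 1
  · exact List.map_congr_left fun t ht =>
      A.strategy_honestProver N ω.1 C (ω.2 0) v (List.mem_range.1 ht)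
  · exact congrArg (fun D => [fun u => (A.inbox N D v u).map C'.enc])
      (A.messagesOf_honestProver N ω.1 C (ω.2 0))

variable {N} in
lemma simDist_eq_viewDist (hN : N ∈ A.language) (v : Fin n) :
    simDist (A.simulator C C') N 1 v =
      viewDist (A.verifier C C') (A.honestProver N C) N (2 * A.numMsgs) 1 v := by
  let view : SimCoin F n A.numMsgs → View n ℓ b (A.verifier C C').Coin :=
    A.simView C C' (N.input v) (adjRow N.graph v) (N.children v)
  have simDist_eq : simDist (A.simulator C C') N 1 v =
      (PMF.uniformOfFintype (Fin n → SimCoin F n A.numMsgs)).map (view ∘ fun coins => coins v) := by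
    unfold simDist
    congr 1
    funext coins
    exact A.run_simulator C C' N coins v
  have viewDist_eq : viewDist (A.verifier C C') (A.honestProver N C) N (2 * A.numMsgs) 1 v =
      (PMF.uniformOfFintype (SimCoin F n A.numMsgs)).map (view ∘ A.reveal N v) := by
    unfold viewDist
    congr 1
    funext ω
    exact A.view_eq_simView C C' hN v ω
  rw [simDist_eq, viewDist_eq, ← PMF.map_comp, ← PMF.map_comp, map_uniform_eval,
    map_uniform_of_bijective (Finite.injective_iff_bijective.1 (A.reveal_injective N v))]

end CountingScheme

end Simulator

/-! ### The class of languages -/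

section HasProtocol

variable {n ℓ b r : ℕ}

/-- There is a perfect zero-knowledge protocol for the networks with `n` nodes, with `r` rounds,
messages of `ℓ` bits to and from the prover, and one round of verification with messages of `b`
bits. -/
def HasProtocol (n r ℓ b : ℕ) (L : Set (Network n ℕ)) : Prop :=
  ∃ (V : Verifier n ℓ b ℕ) (honest : Network n ℕ → Prover n ℓ)
    (S : Simulator n b ℕ (View n ℓ b V.Coin)),
    (∀ N ∈ L, 2 / 3 ≤ acceptProb V (honest N) N r 1) ∧
    (∀ N ∉ L, ∀ P : Prover n ℓ, acceptProb V P N r 1 ≤ 1 / 3) ∧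
    (∀ N ∈ L, ∀ v, simDist S N 1 v = viewDist V (honest N) N r 1 v)

lemma two_thirds_le_acceptProb {V : Verifier n ℓ b ℕ} {P : Prover n ℓ} {N : Network n ℕ}
    (h : ∀ ω, AllAccept V P N r 1 ω) : 2 / 3 ≤ acceptProb V P N r 1 := by
  have accept_univ : {ω | AllAccept V P N r 1 ω} = Set.univ := Set.eq_univ_of_forall h
  rw [acceptProb, accept_univ, (PMF.toOuterMeasure_apply_eq_one_iff _ _).2 (Set.subset_univ _)]
  exact ENNReal.div_le_of_le_mul (by norm_num)

open Classical in
lemma hasProtocol_of_label_eq_const {L : Set (Network n ℕ)} {c : ℕ}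
    (hL : ∀ N, N ∈ L ↔ ∀ v, N.label v = c) : HasProtocol n 0 0 0 L := by
  refine ⟨{ Coin := Unit
            respond := fun _ _ _ => default
            verify :=
              { send := fun _ _ _ => default
                out := fun d _ => decide (d.1.label = c) } },
    fun _ => { Seed := Unit, strategy := fun _ _ _ => default },
    { Coin := Unit
      alg :=
        { send := fun _ _ _ => default
          out := fun _ received => ⟨(), [], received⟩ } }, ?_, ?_, ?_⟩
  · exact fun N hN => two_thirds_le_acceptProb fun ω v => decide_eq_true ((hL N).1 hN v)
  · intro N hN P
    refine le_of_eq_of_le ?_ zero_le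
    rw [acceptProb, PMF.toOuterMeasure_apply_eq_zero_iff, Set.disjoint_left]
    exact fun ω _ hω => hN ((hL N).2 fun v => of_decide_eq_true (hω v))
  · intro N _ v
    let view : View n 0 0 Unit :=
      ⟨(), [], [fun u => if N.graph.Adj u v then some default else none]⟩
    exact (PMF.map_const _ view).trans (PMF.map_const _ view).symm

lemma tvDist_self {α : Type} (μ : PMF α) : tvDist μ μ = 0 := by
  simp [tvDist]

lemma dStatZK_of_hasProtocol {r ℓ b : ℕ → ℕ} {L : DistLanguage ℕ}
    (h : ∀ n, HasProtocol n (r n) (ℓ n) (b n) (L n)) : DStatZK r ℓ ⟨1, b⟩ ⟨1, b⟩ L := by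
  choose V honest S complete sound simulated using h
  refine ⟨V, honest, S, complete, sound, fun p => .of_forall fun n N hN v => ?_⟩
  rw [show simDist (S n) N 1 v = _ from simulated n N hN v, tvDist_self, mul_zero]
  exact zero_le_one

end HasProtocol

namespace CountingScheme

variable {n : ℕ} (A : CountingScheme n)

/-- A prime field of at least this order has room for the claimed numbers of tuples, and makes the
soundness error at most `1 / 3`. -/
def minModulus : ℕ :=
  max (A.bound + 1) (3 * ((A.numVars + 1) * n + n * A.numMsgs + A.numMsgs))

lemma hasProtocol {q s : ℕ} (hq : q.Prime) (hA : A.minModulus ≤ q) (hs : q ≤ 2 ^ s) :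
    HasProtocol n (2 * A.numMsgs) (6 * s) (4 * s) A.language := by
  have : Fact q.Prime := ⟨hq⟩
  have : NeZero n := ⟨fun hn => absurd A.κ_lt (by omega)⟩
  have card_le : Fintype.card (ZMod q) ≤ 2 ^ s := (ZMod.card q).trans_le hs
  obtain ⟨C⟩ := exists_codec (X := ProverMsg (ZMod q)) (f := fun x =>
    ![x.coin, x.coeff, x.coeff', x.maskShare, x.maskedFactor, x.treeValue])
    (fun ⟨_, _, _, _, _, _⟩ ⟨_, _, _, _, _, _⟩ h => by simpa using h) card_le
  have : Nonempty (NodeMsg (ZMod q)) := ⟨⟨0, 0, 0, 0⟩⟩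
  obtain ⟨C'⟩ := exists_codec (X := NodeMsg (ZMod q)) (f := fun x =>
    ![x.subtreeSum, x.lastCoin, x.fingerprint, x.claim])
    (fun ⟨_, _, _, _⟩ ⟨_, _, _, _⟩ h => by simpa using h) card_le
  have cast_injOn : Set.InjOn (Nat.cast : ℕ → ZMod q) (Set.Iic A.bound) :=
    (CharP.natCast_injOn_Iio (ZMod q) q).mono fun a ha =>
      (Nat.lt_succ_of_le ha).trans_le ((le_max_left _ _).trans hA)
  refine ⟨A.verifier C C', fun N => A.honestProver N C, A.simulator C C', ?_, ?_, ?_⟩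
  · exact fun N hN => two_thirds_le_acceptProb (A.allAccept_honestProver C C' hN)
  · exact fun N hN P => A.acceptProb_le cast_injOn
      (((le_max_right _ _).trans hA).trans_eq (ZMod.card q).symm) C C' P hN
  · exact fun N hN v => A.simDist_eq_viewDist C C' hN v

lemma minModulus_le (hn : 48 * A.m ≤ n) : A.minModulus ≤ A.bound + 1 := by
  have hκ := A.κ_pos
  have hm := A.m_pos
  have soundness_le :
      3 * ((A.numVars + 1) * n + n * A.numMsgs + A.numMsgs) ≤ 24 * (A.numVars * n) := by
    have succ_κ_le : A.κ + 1 ≤ A.numVars := Nat.le_mul_of_pos_right _ hm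
    have numMsgs_le : A.numMsgs ≤ 3 * A.numVars := by
      simp only [numMsgs, lastMsg]
      omega
    calc 3 * ((A.numVars + 1) * n + n * A.numMsgs + A.numMsgs)
        ≤ 3 * ((A.numVars + A.numVars) * n + n * (3 * A.numVars) + n * (3 * A.numVars)) := by
          gcongr
          · omega
          · exact numMsgs_le.trans (Nat.le_mul_of_pos_left _ (by have := A.κ_lt; omega))
      _ = 24 * (A.numVars * n) := by ring
  have succ_κ_le : A.κ + 1 ≤ 2 * n ^ (A.κ - 1) := by
    rcases Nat.lt_or_eq_of_le (Nat.succ_le_of_lt hκ) with hκ | hκ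
    · exact (Nat.succ_le_of_lt A.κ_lt).trans
        ((Nat.le_self_pow (by omega) n).trans (Nat.le_mul_of_pos_left _ two_pos))
    · simp [← hκ]
  refine max_le le_rfl (soundness_le.trans (Nat.le_succ_of_le ?_))
  calc 24 * (A.numVars * n) ≤ 24 * (2 * n ^ (A.κ - 1) * A.m * n) :=
        Nat.mul_le_mul_left _ (Nat.mul_le_mul_right _ (Nat.mul_le_mul_right _ succ_κ_le))
    _ = n ^ (A.κ - 1) * (48 * A.m) * n := by ring
    _ ≤ n ^ (A.κ - 1) * n * n := by gcongr
    _ = A.bound := by rw [← pow_succ, ← pow_succ, bound, Nat.sub_add_cancel hκ]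

end CountingScheme

section CountingLanguage

variable {n k q : ℕ} {count : SimpleGraph (Fin n) → ℕ} {pat : ℕ → ℕ → Bool → Bool} {aut : ℕ}

lemma hasProtocol_of_trivial (hk : k ≤ 1 ∨ n < k) (haut : 0 < aut)
    (hcount : ∀ G, count G * aut = tupleCount pat k G) :
    HasProtocol n 0 0 0 {N | ∃ Δ : ℕ, (∀ v, N.label v = Δ) ∧ count N.graph = Δ} := by
  have count_eq (G : SimpleGraph (Fin n)) : count G = count ⊥ := by
    refine Nat.eq_of_mul_eq_mul_right haut ?_
    rw [hcount, hcount]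
    rcases hk with hk | hk
    · exact tupleCount_eq_of_le_one hk pat G ⊥
    · have hk : Nat.card (Fin n) < k := by rwa [Nat.card_fin]
      rw [tupleCount_eq_zero hk, tupleCount_eq_zero hk]
  refine hasProtocol_of_label_eq_const (c := count ⊥) fun N => ?_
  simp only [Set.mem_ofPred_eq, count_eq, exists_eq_right']

/-- For small `n`, where `q` may be too small, the protocol uses another prime. -/
lemma exists_hasProtocol (hq : q.Prime) (haut : 0 < aut)
    (hcount : ∀ G, count G * aut = tupleCount pat k G) :
    ∃ r ℓ b, HasProtocol n r ℓ b {N | ∃ Δ : ℕ, (∀ v, N.label v = Δ) ∧ count N.graph = Δ} ∧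
      r ≤ 2 * k * (Nat.clog 2 n + 2) ∧
      (48 * Nat.clog 2 n ≤ n → n ^ k < q → ℓ ≤ 6 * Nat.clog 2 q ∧ b ≤ 6 * Nat.clog 2 q) := by
  by_cases hk : k ≤ 1 ∨ n < k
  · exact ⟨0, 0, 0, hasProtocol_of_trivial hk haut hcount, by simp⟩
  obtain ⟨κ, rfl⟩ : ∃ κ, k = κ + 1 := ⟨k - 1, by omega⟩
  let A : CountingScheme n :=
    { κ, m := Nat.clog 2 n, pat, aut, aut_pos := haut, κ_pos := by omega, κ_lt := by omega
      n_le := Nat.le_pow_clog one_lt_two n }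
  have language_eq : A.language = {N | ∃ Δ : ℕ, (∀ v, N.label v = Δ) ∧ count N.graph = Δ} := by
    ext N
    refine exists_congr fun Δ => and_congr_right fun _ => ?_
    rw [show A.aut = aut from rfl, show tupleCount A.pat (A.κ + 1) N.graph = _ from (hcount _).symm,
      Nat.mul_left_inj haut.ne', eq_comm]
  obtain ⟨p, hp, hAp, hpq⟩ : ∃ p, p.Prime ∧ A.minModulus ≤ p ∧ (A.minModulus ≤ q → p = q) := by
    by_cases h : A.minModulus ≤ q
    · exact ⟨q, hq, h, fun _ => rfl⟩
    · obtain ⟨p, hp, hp'⟩ := Nat.exists_infinite_primes A.minModulus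
      exact ⟨p, hp', hp, fun h' => absurd h' h⟩
  refine ⟨_, _, _, language_eq ▸ A.hasProtocol hp hAp (Nat.le_pow_clog one_lt_two p), ?_, ?_⟩
  · have : 0 < A.κ := A.κ_pos
    change 2 * ((κ + 1) * Nat.clog 2 n + κ + 1 + 1) ≤ _
    nlinarith
  · intro hn hnq
    rw [hpq ((A.minModulus_le hn).trans hnq)]
    exact ⟨le_rfl, Nat.mul_le_mul_right _ (by norm_num)⟩

end CountingLanguage

lemma one_le_log {x : ℕ} (hx : 3 ≤ x) : 1 ≤ Real.log x := by
  rw [Real.le_log_iff_exp_le (by positivity)]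
  exact Real.exp_one_lt_three.le.trans (by exact_mod_cast hx)

lemma clog_le_log (x : ℕ) : (Nat.clog 2 x : ℝ) ≤ 3 * Real.log x := by
  obtain hx | hx := lt_or_ge x 2
  · interval_cases x <;> simp
  have clog_lt : (Nat.clog 2 x : ℝ) < Real.logb 2 x + 1 := by
    rw [← Real.natCeil_logb_natCast]
    exact Nat.ceil_lt_add_one (Real.logb_nonneg one_lt_two (by norm_cast; omega))
  have log_two_le : Real.log 2 ≤ Real.log x :=
    Real.log_le_log two_pos (by exact_mod_cast hx)
  have log_two_gt := Real.log_two_gt_d9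
  have logb_add_one_le : Real.logb 2 x + 1 ≤ 3 * Real.log x := by
    rw [Real.logb, div_add_one (by positivity), div_le_iff₀ (by positivity)]
    nlinarith
  exact clog_lt.le.trans logb_add_one_le

lemma eventually_mul_clog_le (c : ℕ) : ∀ᶠ n : ℕ in Filter.atTop, c * Nat.clog 2 n ≤ n := by
  have log_le := (Real.isLittleO_log_id_atTop.comp_tendsto tendsto_natCast_atTop_atTop).bound
    (show (0 : ℝ) < 1 / (3 * c + 1) by positivity)
  filter_upwards [log_le] with n hn
  have clog_le := clog_le_log n
  simp only [comp_apply, id_eq, Real.norm_natCast, Real.norm_of_nonneg (Real.log_natCast_nonneg n),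
    one_div, inv_mul_eq_div] at hn
  rw [le_div_iff₀ (by positivity)] at hn
  have : (c * Nat.clog 2 n : ℝ) ≤ n := by
    nlinarith [Real.log_natCast_nonneg n, (Nat.cast_nonneg c : (0 : ℝ) ≤ c)]
  exact_mod_cast this

lemma eventually_pow_lt {k q : ℕ → ℕ}
    (h : ((∃ B : ℕ, ∀ n, k n ≤ B) ∧ ∀ d : ℕ, ∀ᶠ n : ℕ in Filter.atTop, n ^ d < q n) ∨
      (Filter.Tendsto k Filter.atTop Filter.atTop ∧ ∀ᶠ n : ℕ in Filter.atTop, n ^ k n < q n)) :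
    ∀ᶠ n : ℕ in Filter.atTop, n ^ k n < q n := by
  rcases h with ⟨⟨B, hB⟩, h⟩ | ⟨-, h⟩
  · filter_upwards [h B, Filter.eventually_ge_atTop 1] with n hn one_le
    exact (Nat.pow_le_pow_right one_le (hB n)).trans_lt hn
  · exact h

lemma exists_dStatZK {k q : ℕ → ℕ} (hq : ∀ n, (q n).Prime)
    (hkq : ∀ᶠ n : ℕ in Filter.atTop, n ^ k n < q n) {count : (n : ℕ) → SimpleGraph (Fin n) → ℕ}
    {pat : ℕ → ℕ → ℕ → Bool → Bool} {aut : ℕ → ℕ} (haut : ∀ n, 0 < aut n)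
    (hcount : ∀ n G, count n G * aut n = tupleCount (pat n) (k n) G) :
    ∃ (r ℓ : ℕ → ℕ) (A : AlgClass),
      (∀ᶠ n : ℕ in Filter.atTop, (r n : ℝ) ≤ (18 : ℕ) * (k n * Real.log n)) ∧
      (∀ᶠ n : ℕ in Filter.atTop, (ℓ n : ℝ) ≤ (18 : ℕ) * Real.log (q n)) ∧
      A.rounds ≤ 18 ∧
      (∀ᶠ n : ℕ in Filter.atTop, (A.bits n : ℝ) ≤ (18 : ℕ) * Real.log (q n)) ∧
      DStatZK r ℓ A A fun n => {N | ∃ Δ : ℕ, (∀ v, N.label v = Δ) ∧ count n N.graph = Δ} := by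
  choose r ℓ b hprot hr hbits using fun n => exists_hasProtocol (hq n) (haut n) (hcount n)
  have bits_le : ∀ᶠ n in Filter.atTop, (ℓ n : ℝ) ≤ (18 : ℕ) * Real.log (q n) ∧
      (b n : ℝ) ≤ (18 : ℕ) * Real.log (q n) := by
    filter_upwards [hkq, eventually_mul_clog_le 48] with n hnq hn
    have le_log {x : ℕ} (hx : x ≤ 6 * Nat.clog 2 (q n)) : (x : ℝ) ≤ (18 : ℕ) * Real.log (q n) :=
      calc (x : ℝ) ≤ 6 * Nat.clog 2 (q n) := by exact_mod_cast hx
        _ ≤ 6 * (3 * Real.log (q n)) := by gcongr; exact clog_le_log (q n)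
        _ = (18 : ℕ) * Real.log (q n) := by push_cast; ring
    exact (hbits n hn hnq).imp le_log le_log
  refine ⟨r, ℓ, ⟨1, b⟩, ?_, bits_le.mono fun n h => h.1, by norm_num,
    bits_le.mono fun n h => h.2, dStatZK_of_hasProtocol hprot⟩
  filter_upwards [Filter.eventually_ge_atTop 3] with n hn
  have one_le := one_le_log hn
  calc (r n : ℝ) ≤ 2 * k n * (Nat.clog 2 n + 2) := by exact_mod_cast hr n
    _ ≤ 2 * k n * (3 * Real.log n + 6 * Real.log n) := by
      gcongr
      · exact clog_le_log n
      · linarith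
    _ = (18 : ℕ) * (k n * Real.log n) := by push_cast; ring

end DistZK

end

theorem mainTheorem3_general :
    ∃ K : ℕ, ∀ (k q : ℕ → ℕ) (H : (n : ℕ) → SimpleGraph (Fin (k n))),
      (∀ n, (q n).Prime) →
      (∀ᶠ n : ℕ in Filter.atTop, n ^ k n < q n) →
      ∀ L ∈ ({DistZK.subgraphCounting H, DistZK.inducedSubgraphCounting H} :
          Set (DistZK.DistLanguage ℕ)),
        ∃ (r ℓ : ℕ → ℕ) (A : DistZK.AlgClass),
          (∀ᶠ n : ℕ in Filter.atTop, (r n : ℝ) ≤ K * (k n * Real.log n)) ∧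
          (∀ᶠ n : ℕ in Filter.atTop, (ℓ n : ℝ) ≤ K * Real.log (q n)) ∧
          A.rounds ≤ K ∧
          (∀ᶠ n : ℕ in Filter.atTop, (A.bits n : ℝ) ≤ K * Real.log (q n)) ∧
          DistZK.DStatZK r ℓ A A L := by
  refine ⟨18, fun k q H hq hkq L hL => ?_⟩
  have aut_pos n := DistZK.card_iso_self_pos (H n)
  rcases hL with rfl | rfl
  · exact DistZK.exists_dStatZK hq hkq aut_pos fun n G =>
      (DistZK.tupleCount_copyPattern G (H n)).symm
  · exact DistZK.exists_dStatZK hq hkq aut_pos fun n G =>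
      (DistZK.tupleCount_inducedPattern G (H n)).symm

theorem mainTheorem3 :
    ∃ K : ℕ, ∀ (k q : ℕ → ℕ) (H : (n : ℕ) → SimpleGraph (Fin (k n))),
      (∀ n, (q n).Prime) →
      (((∃ B : ℕ, ∀ n, k n ≤ B) ∧ ∀ d : ℕ, ∀ᶠ n : ℕ in Filter.atTop, n ^ d < q n) ∨
        (Filter.Tendsto k Filter.atTop Filter.atTop ∧
          ∀ᶠ n : ℕ in Filter.atTop, n ^ k n < q n)) →
      ∀ L ∈ ({DistZK.subgraphCounting H, DistZK.inducedSubgraphCounting H} :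
          Set (DistZK.DistLanguage ℕ)),
        ∃ (r ℓ : ℕ → ℕ) (A : DistZK.AlgClass),
          (∀ᶠ n : ℕ in Filter.atTop, (r n : ℝ) ≤ K * (k n * Real.log n)) ∧
          (∀ᶠ n : ℕ in Filter.atTop, (ℓ n : ℝ) ≤ K * Real.log (q n)) ∧
          A.rounds ≤ K ∧
          (∀ᶠ n : ℕ in Filter.atTop, (A.bits n : ℝ) ≤ K * Real.log (q n)) ∧
          DistZK.DStatZK r ℓ A A L := by
  obtain ⟨K, hK⟩ := mainTheorem3_general
  exact ⟨K, fun k q H hq hkq => hK k q H hq (DistZK.eventually_pow_lt hkq)⟩
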